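/- Let $\lambda:\mathbb R\to\mathbb R$ be continuous, bounded and nonconstant, acting coordinatewise on vectors. A *one-hidden-layer network* $\mathbb R^a\to\mathbb R^c$ is a map $x\mapsto C\,\lambda(Ax+b)$ with $p\in\mathbb N$, $A\in\mathbb R^{p\times a}$, $b\in\mathbb R^p$, $C\in\mathbb R^{c\times p}$. For $K\subset\mathbb R^a$ let $\mathcal M_+^1(K)$ be the set of Borel probability measures on $K$ with the topology of convergence in law, and let $$W_1(\mu,\nu)=\inf_{\pi_1=\mu,\ \pi_2=\nu}\int\|x-y\|\,d\pi(x,y)$$ be the 1-Wasserstein distance for the Euclidean norm, the infimum being over couplings $\pi$ of $\mu$ and $\nu$. **(1) Real-valued maps.** Let $\Omega\subset\mathbb R^d$ be compact and $\mathcal F:\mathcal M_+^1(\Omega)\to\mathbb R$ continuous. For every $\varepsilon>0$ there are an integer $N$ and one-hidden-layer networks $g_\theta(x)=C_1\lambda(A_1x+b_1):\mathbb R^d\to\mathbb R^N$ and $f_\xi(z)=C_2\lambda(A_2z+b_2):\mathbb R^N\to\mathbb R$ such that $$\forall \alpha\in\mathcal M_+^1(\Omega),\qquad \bigl|\mathcal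 F(\alpha)-f_\xi\bigl(\mathbb E_{X\sim\alpha}\,g_\theta(X)\bigr)\bigr|<\varepsilon .$$ **(2) Measure-valued maps.** For $f:\mathbb R^a\times\mathbb R^a\to\mathbb R^c$ let the elementary block $T_f$ map the law $\alpha$ of a random vector $X$ to the law of $\mathbb E_{X'}[f(X,X')]$, where $X'$ is an independent copy of $X$ and the expectation is over $X'$ only; that is, $T_f(\alpha)$ is the push-forward of $\alpha$ by $x\mapsto\int f(x,x')\,d\alpha(x')$. Let $\Lambda$ map the law of $X$ to the law of $(X,U)$, where $U$ is independent of $X$ and uniform on $[0,1]^r$. Let $\mathcal X\subset\mathbb R^q$ and $\mathcal Y\subset\mathbb R^r$ be compact, let $\mathcal F:\mathcal M_+^1(\mathcal X)\to\mathcal M_+^1(\mathcal Y)$ be continuous, and let $\varepsilon>0$. Measures on $\mathcal X$ and $\mathcal Y$ are regarded as measures on $\mathbb R^q$ and $\mathbb R^r$. (a) There are integers $n,m$ and maps $f:\mathbb R^q\times\mathbb R^q\to\mathbb R^n$, $g:\mathbb R^n\times\mathbb R^n\to\mathbb R^m$, $h:\mathbb R^{m+r}\times\mathbb R^{m+r}\to\mathbb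 R^r$, each a one-hidden-layer network in the concatenation $[x;x']$ of its two arguments, such that $$\forall\alpha\in\mathcal M_+^1(\mathcal X),\qquad W_1\bigl(\mathcal F(\alpha),\,T_h\circ\Lambda\circ T_g\circ T_f(\alpha)\bigr)\le\varepsilon .$$ (b) More precisely, whenever continuous maps $f,g,h$ between these spaces (for some $n,m$) satisfy the inequality in (a), then for every $\delta>0$ they can be replaced by one-hidden-layer networks $f',g',h'$ between the same spaces such that $W_1\bigl(\mathcal F(\alpha),T_{h'}\circ\Lambda\circ T_{g'}\circ T_{f'}(\alpha)\bigr)\le\varepsilon+\delta$ for all $\alpha\in\mathcal M_+^1(\mathcal X)$. -/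

import Mathlib

open MeasureTheory

noncomputable section

namespace StochNet

/-- Concatenation `[x; y]` of two vectors. -/
def concat {ι κ : Type} (x : EuclideanSpace ℝ ι) (y : EuclideanSpace ℝ κ) :
    EuclideanSpace ℝ (ι ⊕ κ) :=
  WithLp.toLp 2 (Sum.elim x.ofLp y.ofLp)

/-- The fully connected network with one hidden layer `x ↦ C lam(A x + b)`, where the activation
`lam` acts on each of the `p` hidden coordinates. -/
def fcNet (lam : ℝ → ℝ) {ι κ : Type} [Fintype ι] {p : ℕ} (A : Matrix (Fin p) ι ℝ)
    (b : Fin p → ℝ) (C : Matrix κ (Fin p) ℝ) (x : EuclideanSpace ℝ ι) : EuclideanSpace ℝ κ :=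
  WithLp.toLp 2 (C.mulVec fun i => lam (A.mulVec x.ofLp i + b i))

/-- A map of two vector variables is a fully connected network with one hidden layer
applied to the concatenated input `[x; x']`. -/
def IsPairNet (lam : ℝ → ℝ) {ι κ : Type} [Fintype ι]
    (f : EuclideanSpace ℝ ι → EuclideanSpace ℝ ι → EuclideanSpace ℝ κ) : Prop :=
  ∃ (p : ℕ) (A : Matrix (Fin p) (ι ⊕ ι) ℝ) (b : Fin p → ℝ) (C : Matrix κ (Fin p) ℝ),
    ∀ x x', f x x' = fcNet lam A b C (concat x x')

/-- The elementary block `T_f`, acting on laws: if `X` has law `α`, then `block f α` is the law of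
`E_{X'}(f(X, X'))`, where `X'` is an independent copy of `X`. -/
def block {ι κ : Type} [Fintype ι] [Fintype κ]
    (f : EuclideanSpace ℝ ι → EuclideanSpace ℝ ι → EuclideanSpace ℝ κ)
    (α : Measure (EuclideanSpace ℝ ι)) : Measure (EuclideanSpace ℝ κ) :=
  α.map fun x => ∫ x', f x x' ∂α

/-- The uniform law on the cube `[0,1]^r`. -/
def unifCube (r : ℕ) : Measure (EuclideanSpace ℝ (Fin r)) :=
  volume.restrict {u | ∀ i, u i ∈ Set.Icc (0 : ℝ) 1}

/-- The map `Λ : X ↦ (X, U)` acting on laws, with `U` uniform on `[0,1]^r` and independent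
of `X`. -/
def addNoise {ι : Type} [Fintype ι] (r : ℕ) (α : Measure (EuclideanSpace ℝ ι)) :
    Measure (EuclideanSpace ℝ (ι ⊕ Fin r)) :=
  (α.prod (unifCube r)).map fun z => concat z.1 z.2

/-- The three-block architecture `T_h ∘ Λ ∘ T_g ∘ T_f`. -/
def architecture {q n m r : ℕ}
    (f : EuclideanSpace ℝ (Fin q) → EuclideanSpace ℝ (Fin q) → EuclideanSpace ℝ (Fin n))
    (g : EuclideanSpace ℝ (Fin n) → EuclideanSpace ℝ (Fin n) → EuclideanSpace ℝ (Fin m))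
    (h : EuclideanSpace ℝ (Fin m ⊕ Fin r) → EuclideanSpace ℝ (Fin m ⊕ Fin r) →
      EuclideanSpace ℝ (Fin r))
    (α : Measure (EuclideanSpace ℝ (Fin q))) : Measure (EuclideanSpace ℝ (Fin r)) :=
  block h (addNoise r (block g (block f α)))

/-- The `1`-Wasserstein distance: the infimum of the transport cost over all couplings
(it is `⊤` if there is no coupling). -/
def W1 {E : Type} [PseudoEMetricSpace E] [MeasurableSpace E] (μ ν : Measure E) : ENNReal :=
  ⨅ (π : Measure (E × E)) (_ : π.map Prod.fst = μ ∧ π.map Prod.snd = ν),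
    ∫⁻ z, edist z.1 z.2 ∂π

/-- A probability measure on a subset of a Euclidean space, seen as a measure on that space. -/
def toAmbient {q : ℕ} {K : Set (EuclideanSpace ℝ (Fin q))} (α : ProbabilityMeasure K) :
    Measure (EuclideanSpace ℝ (Fin q)) :=
  (α : Measure K).map Subtype.val

end StochNet

end

namespace StochNet

open Filter Topology ProbabilityTheory

/-! One density theorem, `eq_top_of_ridge_mem`, drives everything. Let `S` be a closed subspace of
`C(K)` containing all `lam (u + b)` with `u` in a point-separating linear space `V`. Mollifying
`lam` makes it smooth. The `k`-th derivative of `ψ (a u + b)` in `a`, taken at `a = 0`, is `ψ⁽ᵏ⁾(b)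
u ^ k`. A bounded nonconstant `ψ` is not a polynomial, so some `ψ⁽ᵏ⁾(b)` is nonzero and every `u ^
k`, hence every `exp u`, lies in `S`. The exponentials of `V` are closed under products, so
Stone–Weierstrass gives `S = ⊤`.

Real-valued maps: the theorem shows that networks are dense on compact sets and that the functionals
`α ↦ ∫ lam (a·x + b) dα` separate probability measures. Stone–Weierstrass on the compact space of
probability measures then approximates the given map by a polynomial in finitely many of these
functionals (`exists_encoder_approx`), and a second network replaces the polynomial.

Measure-valued maps: a partition of unity replaces `F α` by `∑ pᵢ(α) δ_{yᵢ}` with continuous weights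
(`W1_quantize_le`). The weights are approximated through the encoder, which the blocks `f` and `g`
compute. The discrete law is that of a step function of one uniform variable (`map_stepMap`), and
`h` is a continuous ramp version of that step function.

Passing from continuous maps to networks uses uniform continuity block by block
(`exists_block_modulus`). Both architectures are push-forwards of the same measure, so
`W1_map_le_add` bounds the change of `W1` by the mean displacement, without a general triangle
inequality. -/

/-! ### Density of ridge functions in `C(K)`. -/

/-- The function `u ↦ g (u + b)` acting on continuous real functions. -/
def ridge {K : Type*} [TopologicalSpace K] (g : C(ℝ, ℝ)) (u : C(K, ℝ)) (b : ℝ) : C(K, ℝ) :=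
  g.comp (u + ContinuousMap.const K b)

@[simp] lemma ridge_apply {K : Type*} [TopologicalSpace K] (g : C(ℝ, ℝ)) (u : C(K, ℝ)) (b : ℝ)
    (x : K) : ridge g u b x = g (u x + b) := rfl

lemma continuous_ridge {K T : Type*} [TopologicalSpace K] [TopologicalSpace T] (g : C(ℝ, ℝ))
    {u : T → C(K, ℝ)} {b : T → ℝ} (hu : Continuous u) (hb : Continuous b) :
    Continuous fun t => ridge g (u t) (b t) := by
  unfold ridge
  refine g.continuous_postcomp.comp (hu.add ?_)
  exact ContinuousMap.continuous_const'.comp hb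

/-- A polynomial has an antiderivative. -/
lemma exists_polynomial_antideriv (P : Polynomial ℝ) :
    ∃ Q : Polynomial ℝ, Polynomial.derivative Q = P := by
  induction P using Polynomial.induction_on' with
  | add p q hp hq =>
    obtain ⟨a, rfl⟩ := hp
    obtain ⟨b, rfl⟩ := hq
    exact ⟨a + b, by simp⟩
  | monomial n a =>
    refine ⟨Polynomial.monomial (n + 1) (a / (n + 1)), ?_⟩
    rw [Polynomial.derivative_monomial]
    congr 1
    push_cast
    field_simp

/-- A smooth function with a vanishing iterated derivative is a polynomial. -/
lemma exists_polynomial_of_iteratedDeriv_eq_zero (k : ℕ) (ψ : ℝ → ℝ) (hψ : ContDiff ℝ (⊤ : ℕ∞) ψ)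
    (h : ∀ x, iteratedDeriv k ψ x = 0) : ∃ P : Polynomial ℝ, ∀ x, ψ x = P.eval x := by
  induction k generalizing ψ with
  | zero => exact ⟨0, by simpa using h⟩
  | succ k ih =>
    have hd : ContDiff ℝ (⊤ : ℕ∞) (deriv ψ) := by
      exact (contDiff_infty_iff_deriv.1 hψ).2
    obtain ⟨P, hP⟩ := ih (deriv ψ) hd (by simpa [iteratedDeriv_succ'] using h)
    obtain ⟨Q, rfl⟩ := exists_polynomial_antideriv P
    have hψd : Differentiable ℝ ψ := hψ.differentiable (by simp)
    have := is_const_of_deriv_eq_zero (f := fun x => ψ x - Q.eval x)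
      (hψd.sub Q.differentiable) (fun x => by
        rw [deriv_fun_sub (hψd x) Q.differentiableAt, hP]; simp)
    refine ⟨Q + Polynomial.C (ψ 0 - Q.eval 0), fun x => ?_⟩
    have := this x 0
    simp at this ⊢
    linarith

/-- No iterated derivative of a bounded nonconstant smooth function vanishes identically. -/
lemma exists_iteratedDeriv_ne_zero (k : ℕ) (ψ : ℝ → ℝ) (hψ : ContDiff ℝ (⊤ : ℕ∞) ψ)
    {M : ℝ} (hM : ∀ x, |ψ x| ≤ M) (hne : ∃ s t, ψ s ≠ ψ t) : ∃ x, iteratedDeriv k ψ x ≠ 0 := by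
  by_contra! h
  obtain ⟨P, hP⟩ := exists_polynomial_of_iteratedDeriv_eq_zero k ψ hψ h
  have hdeg : P.degree ≤ 0 := by
    rw [← Polynomial.isBoundedUnder_abs_atTop_iff]
    exact ⟨M, eventually_map.2 (Eventually.of_forall fun x => by simpa [← hP] using hM x)⟩
  obtain ⟨s, t, hst⟩ := hne
  apply hst
  rw [hP, hP, Polynomial.eq_C_of_degree_le_zero hdeg]
  simp

section Closed

variable {K : Type*} [TopologicalSpace K] [CompactSpace K]

/-- A closed subspace of a Banach space is stable under Bochner integration. -/
lemma integral_mem_of_isClosed {E X : Type*} [NormedAddCommGroup E] [NormedSpace ℝ E]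
    [CompleteSpace E] [MeasurableSpace X] (μ : Measure X) (S : Submodule ℝ E)
    (hS : IsClosed (S : Set E)) {f : X → E} (hf : Integrable f μ) (h : ∀ x, f x ∈ S) :
    ∫ x, f x ∂μ ∈ S := by
  have : IsClosed (S : Set E) := hS
  -- The quotient map to `E ⧸ S` is continuous and linear, hence commutes with the integral, and it
  -- kills the integrand.
  rw [← Submodule.Quotient.mk_eq_zero]
  have := S.mkQL.integral_comp_comm hf
  have h0 : ∀ x, S.mkQL (f x) = 0 := fun x => (Submodule.Quotient.mk_eq_zero S).2 (h x)
  simp only [h0, integral_zero] at this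
  exact this.symm

/-- The derivative is taken in the sup norm. Pointwise differentiation gives the fundamental theorem
of calculus at each point of `K`, hence an identity with a `C(K)`-valued integral of a continuous
integrand; differentiating that integral avoids any uniform estimate of difference quotients. -/
lemma hasDerivAt_ridge (g g' : C(ℝ, ℝ)) (hg : ∀ x, HasDerivAt g (g' x) x) (u : C(K, ℝ))
    (a b : ℝ) : HasDerivAt (fun a : ℝ => ridge g (a • u) b) (u * ridge g' (a • u) b) a := by
  have hc : Continuous fun s : ℝ => u * ridge g' (s • u) b :=
    continuous_const.mul (continuous_ridge _ (by fun_prop) continuous_const)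
  have key : ∀ s : ℝ, ridge g (s • u) b =
      ridge g ((0 : ℝ) • u) b + ∫ t in (0 : ℝ)..s, u * ridge g' (t • u) b := by
    intro s
    ext x
    have h1 := (ContinuousMap.evalCLM ℝ x).intervalIntegral_comp_comm
      (μ := volume) (hc.intervalIntegrable 0 s)
    have h2 : ∫ t in (0 : ℝ)..s, u x * g' (t * u x + b) = g (s * u x + b) - g (0 * u x + b) := by
      refine intervalIntegral.integral_eq_sub_of_hasDerivAt (f := fun t => g (t * u x + b))
        (fun t _ => ?_) (Continuous.intervalIntegrable (by fun_prop) _ _)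
      have := (hg (t * u x + b)).comp t (((hasDerivAt_id t).mul_const (u x)).add_const b)
      simpa [mul_comm, Function.comp_def] using this
    simp only [ContinuousMap.evalCLM_apply, ContinuousMap.mul_apply, ridge_apply,
      ContinuousMap.smul_apply, smul_eq_mul] at h1
    rw [ContinuousMap.add_apply, ← h1, h2]
    simp
  have := (intervalIntegral.integral_hasDerivAt_right (hc.intervalIntegrable 0 a)
    (hc.stronglyMeasurableAtFilter _ _) hc.continuousAt).const_add (ridge g ((0 : ℝ) • u) b)
  exact this.congr_of_eventuallyEq (Eventually.of_forall fun s => key s)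

lemma hasDerivAt_mem_of_isClosed {E : Type*} [NormedAddCommGroup E] [NormedSpace ℝ E]
    (S : Submodule ℝ E) (hS : IsClosed (S : Set E)) {f : ℝ → E} {f' : E} {a : ℝ}
    (hf : HasDerivAt f f' a) (h : ∀ x, f x ∈ S) : f' ∈ S := by
  refine hS.mem_of_tendsto (hasDerivAt_iff_tendsto_slope.1 hf) (Eventually.of_forall fun x => ?_)
  exact S.smul_mem _ (S.sub_mem (h x) (h a))

/-- Each derivative in `a` produces one more factor `u`, and a derivative of an `S`-valued curve
stays in the closed subspace `S`. -/
lemma pow_mul_ridge_iteratedDeriv_mem (S : Submodule ℝ C(K, ℝ)) (hS : IsClosed (S : Set C(K, ℝ)))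
    (u : C(K, ℝ)) (ψ : C(ℝ, ℝ)) (hψ : ContDiff ℝ (⊤ : ℕ∞) ψ)
    (h : ∀ a b : ℝ, ridge ψ (a • u) b ∈ S) (k : ℕ) (a b : ℝ) :
    u ^ k * ridge ⟨iteratedDeriv k ψ, hψ.continuous_iteratedDeriv k (by exact_mod_cast le_top)⟩
      (a • u) b ∈ S := by
  induction k generalizing a b with
  | zero =>
    convert h a b using 1
    ext x
    simp
  | succ k ih =>
    have hc : ∀ k, Continuous (iteratedDeriv k ψ) := fun k =>
      hψ.continuous_iteratedDeriv k (by exact_mod_cast le_top)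
    have hd := (hasDerivAt_ridge ⟨iteratedDeriv k ψ, hc k⟩ ⟨iteratedDeriv (k + 1) ψ, hc (k + 1)⟩
      (fun x => by
        have : DifferentiableAt ℝ (iteratedDeriv k ψ) x :=
          (hψ.differentiable_iteratedDeriv k (by exact_mod_cast ENat.natCast_lt_top k)) x
        simpa [iteratedDeriv_succ] using this.hasDerivAt) u a b).const_mul (u ^ k)
    have := hasDerivAt_mem_of_isClosed S hS hd (fun s => ih s b)
    rw [← mul_assoc, ← pow_succ] at this
    exact this

/-- At `a = 0` the ridge factor is the constant `ψ⁽ᵏ⁾(b)`, which is divided out for a `b` where it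
does not vanish. -/
lemma pow_mem_of_ridge_mem (S : Submodule ℝ C(K, ℝ)) (hS : IsClosed (S : Set C(K, ℝ)))
    (u : C(K, ℝ)) (ψ : C(ℝ, ℝ)) (hψ : ContDiff ℝ (⊤ : ℕ∞) ψ) {M : ℝ} (hM : ∀ x, |ψ x| ≤ M)
    (hne : ∃ s t, ψ s ≠ ψ t) (h : ∀ a b : ℝ, ridge ψ (a • u) b ∈ S) (k : ℕ) : u ^ k ∈ S := by
  obtain ⟨b, hb⟩ := exists_iteratedDeriv_ne_zero k ψ hψ hM hne
  have := S.smul_mem (iteratedDeriv k ψ b)⁻¹ (pow_mul_ridge_iteratedDeriv_mem S hS u ψ hψ h k 0 b)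
  convert this using 1
  ext x
  simp
  field_simp

/-- A continuous bounded nonconstant function has a smooth bounded nonconstant mollification. -/
lemma exists_mollification (lam : C(ℝ, ℝ)) {M : ℝ} (hM : ∀ t, |lam t| ≤ M)
    (hne : ∃ s t, lam s ≠ lam t) :
    ∃ φ : ℝ → ℝ, Continuous φ ∧ HasCompactSupport φ ∧ ∃ ψ : C(ℝ, ℝ), ContDiff ℝ (⊤ : ℕ∞) ψ ∧
      (∀ x, ψ x = ∫ s, φ s * lam (x - s)) ∧ (∀ x, |ψ x| ≤ M) ∧ ∃ s t, ψ s ≠ ψ t := by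
  obtain ⟨s, t, hst⟩ := hne
  let φ : ℕ → ContDiffBump (0 : ℝ) := fun n =>
    ⟨1 / (2 * (n + 1)), 1 / (n + 1), by positivity, by
      have : (0 : ℝ) < n + 1 := by positivity
      rw [div_lt_div_iff₀ (by positivity) this]; linarith⟩
  have hφ : Tendsto (fun n => (φ n).rOut) atTop (𝓝 0) := tendsto_one_div_add_atTop_nhds_zero_nat
  have hl : ∀ x, Tendsto (fun n => (convolution ((φ n).normed volume) lam
      (ContinuousLinearMap.lsmul ℝ ℝ) volume) x) atTop (𝓝 (lam x)) := fun x =>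
    ContDiffBump.convolution_tendsto_right_of_continuous hφ lam.continuous x
  -- If no mollification separated `s` from `t`, neither would their pointwise limit `lam`.
  obtain ⟨n, hn⟩ : ∃ n, convolution ((φ n).normed volume) lam
      (ContinuousLinearMap.lsmul ℝ ℝ) volume s ≠ convolution ((φ n).normed volume) lam
      (ContinuousLinearMap.lsmul ℝ ℝ) volume t := by
    by_contra! h
    exact hst (tendsto_nhds_unique ((hl s).congr h) (hl t))
  have hcd : ContDiff ℝ (⊤ : ℕ∞) (convolution ((φ n).normed volume) lam
      (ContinuousLinearMap.lsmul ℝ ℝ) volume) :=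
    (φ n).hasCompactSupport_normed.contDiff_convolution_left _ (φ n).contDiff_normed
      lam.continuous.locallyIntegrable
  have hint : ∀ x, Integrable (fun s => (φ n).normed volume s * lam (x - s)) := fun x =>
    ((φ n).continuous_normed.mul (by fun_prop)).integrable_of_hasCompactSupport
      (φ n).hasCompactSupport_normed.mul_right
  refine ⟨(φ n).normed volume, (φ n).continuous_normed, (φ n).hasCompactSupport_normed,
    ⟨_, hcd.continuous⟩, hcd, fun x => by simp [convolution], fun x => ?_, s, t, hn⟩
  have : |∫ s, (φ n).normed volume s * lam (x - s)| ≤ ∫ s, (φ n).normed volume s * M := by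
    refine (abs_integral_le_integral_abs).trans (integral_mono (hint x).abs
      ((φ n).integrable_normed.mul_const M) fun s => ?_)
    simp only [abs_mul, abs_of_nonneg ((φ n).nonneg_normed s)]
    exact mul_le_mul_of_nonneg_left (hM _) ((φ n).nonneg_normed s)
  rw [integral_mul_const, (φ n).integral_normed, one_mul] at this
  simpa [convolution] using this

/-- The mollified ridge is a Bochner integral in `C(K)` of multiples of shifted ridges `lam (u + (b
- s))`, all of which lie in `S`. -/
lemma ridge_mollification_mem (S : Submodule ℝ C(K, ℝ)) (hS : IsClosed (S : Set C(K, ℝ)))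
    (u : C(K, ℝ)) (lam ψ : C(ℝ, ℝ)) (φ : ℝ → ℝ) (hφ : Continuous φ) (hφc : HasCompactSupport φ)
    (hψ : ∀ x, ψ x = ∫ s, φ s * lam (x - s)) (h : ∀ b : ℝ, ridge lam u b ∈ S) (b : ℝ) :
    ridge ψ u b ∈ S := by
  have hc : Continuous fun s : ℝ => φ s • ridge lam u (b - s) :=
    hφ.smul (continuous_ridge _ continuous_const (by fun_prop))
  have hi : Integrable fun s : ℝ => φ s • ridge lam u (b - s) :=
    hc.integrable_of_hasCompactSupport hφc.smul_right
  have : ridge ψ u b = ∫ s, φ s • ridge lam u (b - s) := by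
    ext x
    have h1 := (ContinuousMap.evalCLM ℝ x).integral_comp_comm hi
    rw [← ContinuousMap.evalCLM_apply ℝ x (∫ s, φ s • ridge lam u (b - s)), ← h1]
    simp [hψ, add_sub_assoc]
  rw [this]
  exact integral_mem_of_isClosed _ S hS hi fun s => S.smul_mem _ (h _)

lemma exp_mem_of_pow_mem (S : Submodule ℝ C(K, ℝ)) (hS : IsClosed (S : Set C(K, ℝ)))
    (u : C(K, ℝ)) (h : ∀ k : ℕ, u ^ k ∈ S) : NormedSpace.exp u ∈ S := by
  refine hS.mem_of_tendsto (NormedSpace.exp_series_hasSum_exp' (𝕂 := ℝ) u)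
    (Eventually.of_forall fun s => S.sum_mem fun k _ => S.smul_mem _ (h k))

lemma continuousMap_exp_apply (u : C(K, ℝ)) (x : K) :
    (NormedSpace.exp u : C(K, ℝ)) x = Real.exp (u x) := by
  rw [Real.exp_eq_exp_ℝ]
  exact NormedSpace.map_exp (ContinuousMap.evalAlgHom ℝ ℝ x : C(K, ℝ) →ₐ[ℝ] ℝ)
    (continuous_eval_const x) u

/-- Universal approximation: a closed space of continuous functions on a compact space that
contains `lam (u + b)` for all `b` and all `u` in a linear space separating the points
is everything. -/
theorem eq_top_of_ridge_mem (lam : C(ℝ, ℝ)) {M : ℝ} (hM : ∀ t, |lam t| ≤ M)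
    (hne : ∃ s t, lam s ≠ lam t) (V : Submodule ℝ C(K, ℝ))
    (hV : ∀ x y : K, x ≠ y → ∃ u ∈ V, u x ≠ u y)
    (S : Submodule ℝ C(K, ℝ)) (hS : IsClosed (S : Set C(K, ℝ)))
    (h : ∀ u ∈ V, ∀ b : ℝ, ridge lam u b ∈ S) : S = ⊤ := by
  obtain ⟨φ, hφ, hφc, ψ, hψ, hψφ, hψM, hψne⟩ := exists_mollification lam hM hne
  have hexp : ∀ u ∈ V, NormedSpace.exp u ∈ S := fun u hu =>
    exp_mem_of_pow_mem S hS u <| pow_mem_of_ridge_mem S hS u ψ hψ hψM hψne fun a b =>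
      ridge_mollification_mem S hS _ lam ψ φ hφ hφc hψφ (h _ (V.smul_mem a hu)) b
  let N : Submonoid C(K, ℝ) :=
    { carrier := {w | ∃ u ∈ V, NormedSpace.exp u = w}
      one_mem' := ⟨0, V.zero_mem, NormedSpace.exp_zero⟩
      mul_mem' := by
        rintro _ _ ⟨u, hu, rfl⟩ ⟨v, hv, rfl⟩
        exact ⟨u + v, V.add_mem hu hv, NormedSpace.exp_add⟩ }
  -- The exponentials already form a submonoid, so the algebra they generate is merely their linear
  -- span.
  have hA : Subalgebra.toSubmodule (Algebra.adjoin ℝ (N : Set C(K, ℝ))) ≤ S := by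
    rw [Algebra.adjoin_eq_span, Submonoid.closure_eq, Submodule.span_le]
    rintro _ ⟨u, hu, rfl⟩
    exact hexp u hu
  have hsep : (Algebra.adjoin ℝ (N : Set C(K, ℝ))).SeparatesPoints := by
    intro x y hxy
    obtain ⟨u, hu, hne⟩ := hV x y hxy
    refine ⟨_, ⟨NormedSpace.exp u, Algebra.subset_adjoin ⟨u, hu, rfl⟩, rfl⟩, ?_⟩
    simpa [continuousMap_exp_apply] using hne
  have htop := ContinuousMap.subalgebra_topologicalClosure_eq_top_of_separatesPoints _ hsep
  rw [eq_top_iff]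
  intro w _
  have hw : w ∈ (Algebra.adjoin ℝ (N : Set C(K, ℝ))).topologicalClosure := htop ▸ trivial
  exact closure_minimal (s := (Algebra.adjoin ℝ (N : Set C(K, ℝ)) : Set C(K, ℝ)))
    (fun v hv => hA hv) hS hw

end Closed

/-! ### Networks on compact subsets of Euclidean space. -/

/-- The restrictions to `K` of the linear forms `x ↦ ∑ j, a j * x j`. -/
def linearForm {ι : Type} [Fintype ι] (K : Set (EuclideanSpace ℝ ι)) : (ι → ℝ) →ₗ[ℝ] C(K, ℝ) where
  toFun a := ⟨fun x => ∑ j, a j * x.1 j, by fun_prop⟩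
  map_add' a b := by ext x; simp [add_mul, Finset.sum_add_distrib]
  map_smul' c a := by ext x; simp [Finset.mul_sum, mul_assoc]

@[simp] lemma linearForm_apply {ι : Type} [Fintype ι] (K : Set (EuclideanSpace ℝ ι)) (a : ι → ℝ)
    (x : K) : linearForm K a x = ∑ j, a j * x.1 j := rfl

theorem eq_top_of_ridge_linearForm_mem {ι : Type} [Fintype ι] {K : Set (EuclideanSpace ℝ ι)}
    [CompactSpace K] (lam : C(ℝ, ℝ)) {M : ℝ} (hM : ∀ t, |lam t| ≤ M)
    (hne : ∃ s t, lam s ≠ lam t) (S : Submodule ℝ C(K, ℝ)) (hS : IsClosed (S : Set C(K, ℝ)))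
    (h : ∀ (a : ι → ℝ) (b : ℝ), ridge lam (linearForm K a) b ∈ S) : S = ⊤ := by
  classical
  refine eq_top_of_ridge_mem lam hM hne (LinearMap.range (linearForm K)) (fun x y hxy => ?_) S hS ?_
  · obtain ⟨i, hi⟩ : ∃ i, x.1 i ≠ y.1 i := by
      by_contra! hc
      exact hxy (Subtype.ext (PiLp.ext hc))
    exact ⟨_, ⟨Pi.single i 1, rfl⟩, by simpa [Pi.single_apply] using hi⟩
  · rintro _ ⟨a, rfl⟩ b
    exact h a b

lemma exists_scalar_net_approx {ι : Type} [Fintype ι] {K : Set (EuclideanSpace ℝ ι)}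
    [CompactSpace K] (lam : C(ℝ, ℝ)) {M : ℝ} (hM : ∀ t, |lam t| ≤ M)
    (hne : ∃ s t, lam s ≠ lam t) (w : C(K, ℝ)) {ε : ℝ} (hε : 0 < ε) :
    ∃ (p : ℕ) (A : Fin p → ι → ℝ) (b c : Fin p → ℝ), ∀ x : K,
      |w x - ∑ i, c i * lam (∑ j, A i j * x.1 j + b i)| < ε := by
  let S0 : Submodule ℝ C(K, ℝ) :=
    Submodule.span ℝ (Set.range fun z : (ι → ℝ) × ℝ => ridge lam (linearForm K z.1) z.2)
  have htop : S0.topologicalClosure = ⊤ :=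
    eq_top_of_ridge_linearForm_mem lam hM hne _ S0.isClosed_topologicalClosure fun a b =>
      S0.le_topologicalClosure (Submodule.subset_span ⟨(a, b), rfl⟩)
  have hw : w ∈ closure (S0 : Set C(K, ℝ)) := by
    rw [← Submodule.topologicalClosure_coe, htop]; trivial
  obtain ⟨v, hv, hwv⟩ := Metric.mem_closure_iff.1 hw ε hε
  obtain ⟨p, c, z, rfl⟩ := Submodule.mem_span_set'.1 hv
  choose ab hab using fun i => (z i).2
  refine ⟨p, fun i => (ab i).1, fun i => (ab i).2, c, fun x => ?_⟩
  have := (ContinuousMap.dist_apply_le_dist x).trans_lt hwv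
  rw [Real.dist_eq] at this
  simpa [← hab, ContinuousMap.sum_apply] using this

lemma euclidean_norm_le_sum {κ : Type} [Fintype κ] (x : EuclideanSpace ℝ κ) :
    ‖x‖ ≤ ∑ k, |x k| := by
  rw [EuclideanSpace.norm_eq, Real.sqrt_le_iff]
  exact ⟨Finset.sum_nonneg fun _ _ => abs_nonneg _, by
    simpa using Finset.sum_sq_le_sq_sum_of_nonneg (s := Finset.univ) (f := fun k => |x k|)
      (fun _ _ => abs_nonneg _)⟩

lemma euclidean_norm_le_of_forall_abs_le {κ : Type} [Fintype κ] (x : EuclideanSpace ℝ κ) {η : ℝ}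
    (hη : 0 ≤ η) (h : ∀ k, |x k| ≤ η / (Fintype.card κ + 1)) : ‖x‖ ≤ η := by
  refine (euclidean_norm_le_sum x).trans ((Finset.sum_le_sum fun k _ => h k).trans ?_)
  rw [Finset.sum_const, Finset.card_univ, nsmul_eq_mul, ← mul_div_assoc,
    div_le_iff₀ (by positivity)]
  nlinarith

/-- One-hidden-layer networks approximate continuous maps uniformly on compact sets. -/
theorem exists_fcNet_approx {lam : ℝ → ℝ} (hcont : Continuous lam)
    (hbdd : ∃ M : ℝ, ∀ t, |lam t| ≤ M) (hne : ∃ s t, lam s ≠ lam t)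
    {ι κ : Type} [Fintype ι] [Fintype κ] {K : Set (EuclideanSpace ℝ ι)} (hK : IsCompact K)
    {g : EuclideanSpace ℝ ι → EuclideanSpace ℝ κ} (hg : Continuous g) {η : ℝ} (hη : 0 < η) :
    ∃ (p : ℕ) (A : Matrix (Fin p) ι ℝ) (b : Fin p → ℝ) (C : Matrix κ (Fin p) ℝ),
      ∀ x ∈ K, ‖g x - fcNet lam A b C x‖ ≤ η := by
  classical
  obtain ⟨M, hM⟩ := hbdd
  have : CompactSpace K := isCompact_iff_compactSpace.1 hK
  choose p A b c h using fun k : κ => exists_scalar_net_approx (K := K) ⟨lam, hcont⟩ hM hne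
    ⟨fun x : K => g x k, by fun_prop⟩ (ε := η / (Fintype.card κ + 1)) (by positivity)
  -- The hidden units of the scalar networks, one network per output coordinate, are stacked into a
  -- single layer; output `k` gives weight zero to the units of the other coordinates.
  let e : (Σ k, Fin (p k)) ≃ Fin (Fintype.card (Σ k, Fin (p k))) := Fintype.equivFin _
  refine ⟨_, fun i => A (e.symm i).1 (e.symm i).2, fun i => b (e.symm i).1 (e.symm i).2,
    fun k i => if (e.symm i).1 = k then c (e.symm i).1 (e.symm i).2 else 0, fun x hx => ?_⟩
  refine euclidean_norm_le_of_forall_abs_le _ hη.le fun k => ?_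
  have := (h k ⟨x, hx⟩).le
  rw [PiLp.sub_apply]
  refine le_of_eq_of_le (congrArg (fun t => |g x k - t|) ?_) this
  simp only [fcNet, Matrix.mulVec, dotProduct]
  refine (e.symm.sum_comp fun s => (if s.1 = k then c s.1 s.2 else 0) *
    lam (∑ j, A s.1 s.2 j * x j + b s.1 s.2)).trans ?_
  simp only [Fintype.sum_sigma, ite_mul, zero_mul]
  rw [Finset.sum_eq_single k]
  · simp
  · intro j _ hj
    simp [hj]
  · simp

lemma continuous_fcNet {lam : ℝ → ℝ} (hcont : Continuous lam) {ι κ : Type} [Fintype ι] [Fintype κ]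
    {p : ℕ} (A : Matrix (Fin p) ι ℝ) (b : Fin p → ℝ) (C : Matrix κ (Fin p) ℝ) :
    Continuous (fcNet lam A b C) := by
  unfold fcNet
  simp only [Matrix.mulVec, dotProduct]
  fun_prop

lemma continuous_concat {ι κ : Type} [Fintype ι] [Fintype κ] :
    Continuous fun z : EuclideanSpace ℝ ι × EuclideanSpace ℝ κ => concat z.1 z.2 := by
  unfold concat
  refine (PiLp.continuous_toLp 2 _).comp (continuous_pi fun i => ?_)
  cases i <;> simp <;> fun_prop

/-- The block of coordinates of a vector that is pulled back by a map of indices. -/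
def coords {ι κ : Type} (e : κ → ι) (w : EuclideanSpace ℝ ι) : EuclideanSpace ℝ κ :=
  WithLp.toLp 2 fun k => w (e k)

@[fun_prop]
lemma continuous_coords {ι κ : Type} [Fintype ι] [Fintype κ] (e : κ → ι) :
    Continuous (coords e) := by
  unfold coords
  fun_prop

@[simp] lemma coords_inl_concat {ι κ : Type} (x : EuclideanSpace ℝ ι) (y : EuclideanSpace ℝ κ) :
    coords Sum.inl (concat x y) = x := rfl

@[simp] lemma coords_inr_concat {ι κ : Type} (x : EuclideanSpace ℝ ι) (y : EuclideanSpace ℝ κ) :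
    coords Sum.inr (concat x y) = y := rfl

lemma IsPairNet.continuous {lam : ℝ → ℝ} (hcont : Continuous lam) {ι κ : Type} [Fintype ι]
    [Fintype κ] {f : EuclideanSpace ℝ ι → EuclideanSpace ℝ ι → EuclideanSpace ℝ κ}
    (hf : IsPairNet lam f) : Continuous (Function.uncurry f) := by
  obtain ⟨p, A, b, C, h⟩ := hf
  have : Function.uncurry f = fun z => fcNet lam A b C (concat z.1 z.2) :=
    funext fun z => h z.1 z.2
  rw [this]
  exact (continuous_fcNet hcont A b C).comp continuous_concat

theorem exists_isPairNet_approx {lam : ℝ → ℝ} (hcont : Continuous lam)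
    (hbdd : ∃ M : ℝ, ∀ t, |lam t| ≤ M) (hne : ∃ s t, lam s ≠ lam t)
    {ι κ : Type} [Fintype ι] [Fintype κ] {K : Set (EuclideanSpace ℝ ι)} (hK : IsCompact K)
    {f : EuclideanSpace ℝ ι → EuclideanSpace ℝ ι → EuclideanSpace ℝ κ}
    (hf : Continuous (Function.uncurry f)) {η : ℝ} (hη : 0 < η) :
    ∃ f' : EuclideanSpace ℝ ι → EuclideanSpace ℝ ι → EuclideanSpace ℝ κ, IsPairNet lam f' ∧
      ∀ x ∈ K, ∀ x' ∈ K, ‖f x x' - f' x x'‖ ≤ η := by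
  obtain ⟨p, A, b, C, h⟩ := exists_fcNet_approx hcont hbdd hne
    ((hK.prod hK).image continuous_concat)
    (g := fun w => Function.uncurry f (coords Sum.inl w, coords Sum.inr w))
    (hf.comp ((continuous_coords _).prodMk (continuous_coords _))) hη
  refine ⟨fun x x' => fcNet lam A b C (concat x x'), ⟨p, A, b, C, fun _ _ => rfl⟩,
    fun x hx x' hx' => ?_⟩
  have := h (concat x x') (Set.mem_image_of_mem _ (Set.mk_mem_prod hx hx'))
  simpa using this

/-! ### Real-valued functions of a measure. -/

/-- Finitely many continuous functions on a compact space are approximated by continuous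
functions of finitely many members of a given family separating the points. -/
theorem exists_approx_comp_of_separates {T I κ : Type*} [TopologicalSpace T] [CompactSpace T]
    [Fintype κ] (f : I → C(T, ℝ)) (hf : ∀ x y, x ≠ y → ∃ i, f i x ≠ f i y) (F : κ → C(T, ℝ))
    {ε : ℝ} (hε : 0 < ε) :
    ∃ (n : ℕ) (idx : Fin n → I) (G : (Fin n → ℝ) → κ → ℝ), Continuous G ∧
      ∀ x k, |F k x - G (fun j => f (idx j) x) k| < ε := by
  classical
  have hsep : (Algebra.adjoin ℝ (Set.range f)).SeparatesPoints := by
    intro x y hxy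
    obtain ⟨i, hi⟩ := hf x y hxy
    exact ⟨_, ⟨f i, Algebra.subset_adjoin ⟨i, rfl⟩, rfl⟩, hi⟩
  have htop := ContinuousMap.subalgebra_topologicalClosure_eq_top_of_separatesPoints _ hsep
  have hP : ∀ k, ∃ P : MvPolynomial I ℝ, dist (F k) (MvPolynomial.aeval f P) < ε := by
    intro k
    have hw : F k ∈ (Algebra.adjoin ℝ (Set.range f)).topologicalClosure := htop ▸ trivial
    obtain ⟨v, hv, hd⟩ := Metric.mem_closure_iff.1 hw ε hε
    have hv' : v ∈ Algebra.adjoin ℝ (Set.range f) := hv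
    rw [Algebra.adjoin_range_eq_range_aeval] at hv'
    obtain ⟨P, rfl⟩ := hv'
    exact ⟨P, hd⟩
  choose P hP using hP
  -- Only the finitely many variables occurring in the polynomials matter; all others are set to
  -- zero.
  let s : Finset I := Finset.univ.biUnion fun k => (P k).vars
  let e : s ≃ Fin (Fintype.card s) := Fintype.equivFin s
  refine ⟨_, fun j => (e.symm j).1,
    fun z k => MvPolynomial.eval (fun i => if h : i ∈ s then z (e ⟨i, h⟩) else 0) (P k), ?_, ?_⟩
  · refine continuous_pi fun k => (MvPolynomial.continuous_eval (P k)).comp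
      (continuous_pi fun i => ?_)
    by_cases h : i ∈ s
    · simp only [h, dif_pos]; fun_prop
    · simp only [h, dif_neg, not_false_eq_true]; fun_prop
  · intro x k
    have h1 := (ContinuousMap.dist_apply_le_dist x).trans_lt (hP k)
    rw [Real.dist_eq] at h1
    have h2 : (MvPolynomial.aeval f (P k)) x = MvPolynomial.eval (fun i => f i x) (P k) := by
      have := MvPolynomial.comp_aeval_apply (f := f)
        (ContinuousMap.evalAlgHom ℝ ℝ x : C(T, ℝ) →ₐ[ℝ] ℝ) (P k)
      rw [← MvPolynomial.coe_aeval_eq_eval]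
      exact this
    rw [h2] at h1
    refine lt_of_eq_of_lt (congrArg (fun t => |F k x - t|) ?_) h1
    refine MvPolynomial.eval₂Hom_congr' rfl (fun i hi _ => ?_) rfl
    have : i ∈ s := Finset.mem_biUnion.2 ⟨k, Finset.mem_univ _, hi⟩
    simp [this]

/-- Integrals of ridge functions determine a probability measure on a compact set. -/
lemma exists_integral_ridge_ne {ι : Type} [Fintype ι] {K : Set (EuclideanSpace ℝ ι)}
    [CompactSpace K] (lam : C(ℝ, ℝ)) {M : ℝ} (hM : ∀ t, |lam t| ≤ M)
    (hne : ∃ s t, lam s ≠ lam t) (α β : ProbabilityMeasure K) (hαβ : α ≠ β) :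
    ∃ z : (ι → ℝ) × ℝ, ∫ x, ridge lam (linearForm K z.1) z.2 x ∂(α : Measure K) ≠
      ∫ x, ridge lam (linearForm K z.1) z.2 x ∂(β : Measure K) := by
  by_contra! h
  have hi : ∀ (γ : ProbabilityMeasure K) (w : C(K, ℝ)), Integrable w (γ : Measure K) :=
    fun γ w => w.continuous.integrable_of_hasCompactSupport (HasCompactSupport.of_compactSpace _)
  -- The functions on which `α` and `β` agree form a closed subspace; if it contains all ridge
  -- functions it is everything, and then `α = β`.
  let S : Submodule ℝ C(K, ℝ) :=
    { carrier := {w | ∫ x, w x ∂(α : Measure K) = ∫ x, w x ∂(β : Measure K)}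
      zero_mem' := by simp
      add_mem' := by
        intro v w hv hw
        simp only [Set.mem_ofPred_eq, ContinuousMap.add_apply] at *
        rw [integral_add (hi _ _) (hi _ _), integral_add (hi _ _) (hi _ _), hv, hw]
      smul_mem' := by
        intro c w hw
        simp only [Set.mem_ofPred_eq, ContinuousMap.smul_apply] at *
        rw [integral_smul, integral_smul, hw] }
  have hc : ∀ γ : ProbabilityMeasure K, Continuous fun w : C(K, ℝ) => ∫ x, w x ∂(γ : Measure K) := by
    intro γ
    refine (LipschitzWith.of_dist_le_mul (K := 1) fun v w => ?_).continuous
    rw [dist_eq_norm, dist_eq_norm, ← integral_sub (hi _ _) (hi _ _)]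
    refine (norm_integral_le_of_norm_le_const (C := ‖v - w‖)
      (Eventually.of_forall fun x => ?_)).trans (by simp)
    exact (v - w).norm_coe_le_norm x
  have hS : S = ⊤ := eq_top_of_ridge_linearForm_mem lam hM hne S
    (isClosed_eq (hc α) (hc β)) fun a b => h (a, b)
  apply hαβ
  apply ProbabilityMeasure.toMeasure_injective
  refine ext_of_forall_integral_eq_of_IsFiniteMeasure fun w => ?_
  have : w.toContinuousMap ∈ S := hS ▸ trivial
  exact this

lemma integral_euclidean_apply {X κ : Type} [MeasurableSpace X] [Fintype κ] {μ : Measure X}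
    {f : X → EuclideanSpace ℝ κ} (hf : Integrable f μ) (k : κ) :
    (∫ x, f x ∂μ) k = ∫ x, f x k ∂μ := by
  exact ((EuclideanSpace.proj (𝕜 := ℝ) k).integral_comp_comm hf).symm

/-- Finitely many continuous functions of a probability measure on a compact set are approximated
by continuous functions of the expectation of a network. -/
theorem exists_encoder_approx {lam : ℝ → ℝ} (hcont : Continuous lam)
    (hbdd : ∃ M : ℝ, ∀ t, |lam t| ≤ M) (hne : ∃ s t, lam s ≠ lam t)
    {ι κ : Type} [Fintype ι] [Fintype κ] {K : Set (EuclideanSpace ℝ ι)} (hK : IsCompact K)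
    (F : κ → ProbabilityMeasure K → ℝ) (hF : ∀ k, Continuous (F k)) {ε : ℝ} (hε : 0 < ε) :
    ∃ (N : ℕ) (A : Matrix (Fin N) ι ℝ) (b : Fin N → ℝ)
      (G : EuclideanSpace ℝ (Fin N) → EuclideanSpace ℝ κ), Continuous G ∧
      ∀ (α : ProbabilityMeasure K) (k : κ),
        |F k α - G (∫ x : K, fcNet lam A b 1 x.1 ∂(α : Measure K)) k| < ε := by
  obtain ⟨M, hM⟩ := hbdd
  have : CompactSpace K := isCompact_iff_compactSpace.1 hK
  let L : C(ℝ, ℝ) := ⟨lam, hcont⟩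
  obtain ⟨N, idx, G, hG, h⟩ := exists_approx_comp_of_separates
    (fun z : (ι → ℝ) × ℝ => (⟨fun α : ProbabilityMeasure K =>
      ∫ x, ridge L (linearForm K z.1) z.2 x ∂(α : Measure K),
      ProbabilityMeasure.continuous_integral_continuousMap _⟩ : C(ProbabilityMeasure K, ℝ)))
    (exists_integral_ridge_ne L hM hne) (fun k => ⟨F k, hF k⟩) hε
  -- With the identity as output matrix, the expected network output is the vector of the selected
  -- ridge integrals.
  refine ⟨N, fun j => (idx j).1, fun j => (idx j).2, fun z => WithLp.toLp 2 (G z.ofLp),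
    by fun_prop, fun α k => ?_⟩
  refine lt_of_eq_of_lt (congrArg (fun z => |F k α - G z k|) ?_) (h α k)
  ext j
  rw [integral_euclidean_apply]
  · simp [fcNet, Matrix.mulVec, dotProduct, L]
  · exact ((continuous_fcNet hcont _ _ _).comp continuous_subtype_val).integrable_of_hasCompactSupport
      (HasCompactSupport.of_compactSpace _)

theorem exists_net_approx_of_real_valued {lam : ℝ → ℝ} (hcont : Continuous lam)
    (hbdd : ∃ M : ℝ, ∀ t, |lam t| ≤ M) (hne : ∃ s t, lam s ≠ lam t) (d : ℕ)
    (Ω : Set (EuclideanSpace ℝ (Fin d))) (hΩ : IsCompact Ω) (F : ProbabilityMeasure Ω → ℝ)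
    (hF : Continuous F) (ε : ℝ) (hε : 0 < ε) :
    ∃ (N p₁ p₂ : ℕ)
      (A₁ : Matrix (Fin p₁) (Fin d) ℝ) (b₁ : Fin p₁ → ℝ) (C₁ : Matrix (Fin N) (Fin p₁) ℝ)
      (A₂ : Matrix (Fin p₂) (Fin N) ℝ) (b₂ : Fin p₂ → ℝ) (C₂ : Matrix (Fin 1) (Fin p₂) ℝ),
      ∀ α : ProbabilityMeasure Ω,
        |F α - fcNet lam A₂ b₂ C₂ (∫ x : Ω, fcNet lam A₁ b₁ C₁ x.1 ∂(α : Measure Ω)) 0| < ε := by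
  obtain ⟨N, A, b, G, hG, h⟩ := exists_encoder_approx hcont hbdd hne hΩ
    (fun _ : Fin 1 => F) (fun _ => hF) (half_pos hε)
  have : CompactSpace Ω := isCompact_iff_compactSpace.1 hΩ
  -- A bound for the encoder on `Ω` also bounds its expectations, so the second network need only
  -- approximate `G` on a fixed ball.
  obtain ⟨B, hB⟩ := hΩ.exists_bound_of_continuousOn
    (continuous_fcNet hcont A b (1 : Matrix (Fin N) (Fin N) ℝ)).continuousOn
  obtain ⟨p, A', b', C', h'⟩ := exists_fcNet_approx hcont hbdd hne
    (isCompact_closedBall (0 : EuclideanSpace ℝ (Fin N)) B) hG (η := ε / 4) (by positivity)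
  refine ⟨N, N, p, A, b, 1, A', b', C', fun α => ?_⟩
  set z := ∫ x : Ω, fcNet lam A b (1 : Matrix (Fin N) (Fin N) ℝ) x.1 ∂(α : Measure Ω) with hz
  have hzB : z ∈ Metric.closedBall (0 : EuclideanSpace ℝ (Fin N)) B := by
    rw [mem_closedBall_zero_iff]
    exact (norm_integral_le_of_norm_le_const (Eventually.of_forall fun x : Ω => hB x x.2)).trans
      (by simp)
  have h1 := h α 0
  have h2 : |G z 0 - fcNet lam A' b' C' z 0| ≤ ε / 4 :=
    (PiLp.norm_apply_le (G z - fcNet lam A' b' C' z) 0).trans (h' z hzB)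
  rw [← hz] at h1
  rw [abs_lt] at h1 ⊢
  rw [abs_le] at h2
  constructor <;> linarith

/-! ### Wasserstein distance and stability of the architecture. -/

/-- Changing the map in a push-forward measure changes the Wasserstein distance by at most
the mean displacement. -/
theorem W1_map_le_add {E X : Type} [EMetricSpace E] [SecondCountableTopology E] [MeasurableSpace E]
    [BorelSpace E] [StandardBorelSpace E] [Nonempty E] [MeasurableSpace X] (μ : Measure E)
    (ρ : Measure X) [IsFiniteMeasure ρ] {Φ Φ' : X → E} (hΦ : Measurable Φ) (hΦ' : Measurable Φ') :
    W1 μ (ρ.map Φ') ≤ W1 μ (ρ.map Φ) + ∫⁻ x, edist (Φ x) (Φ' x) ∂ρ := by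
  rw [W1, W1, ENNReal.iInf_add]
  refine le_iInf fun π => ?_
  rw [ENNReal.iInf_add]
  refine le_iInf fun hπ => ?_
  have hfin : IsFiniteMeasure π := by
    refine ⟨?_⟩
    have h := congrArg (fun m => m Set.univ) hπ.2
    simp only [Measure.map_apply measurable_snd MeasurableSet.univ, Set.preimage_univ] at h
    rw [h]
    exact measure_lt_top _ _
  -- Swapping puts the marginal `ρ.map Φ` first, where the disintegration takes place.
  let π' : Measure (E × E) := π.map Prod.swap
  have hfst : π'.fst = ρ.map Φ := by
    rw [← hπ.2, Measure.fst, Measure.map_map measurable_fst measurable_swap]; rfl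
  -- Gluing: the conditional law given `Φ x` is pulled back to `x`. This lifts the coupling to `X ×
  -- E` with first marginal `ρ`, and pairing the second component with `Φ' x` then couples `μ` with
  -- `ρ.map Φ'`.
  let σ : Measure (X × E) := ρ ⊗ₘ (π'.condKernel.comap Φ hΦ)
  have hσ : σ.map (Prod.map Φ id) = π' := by
    refine Measure.ext_of_lintegral _ fun f hf => ?_
    rw [lintegral_map hf (hΦ.prodMap measurable_id)]
    refine (Measure.lintegral_compProd (hf.comp (hΦ.prodMap measurable_id))).trans ?_
    conv_rhs => rw [← π'.disintegrate π'.condKernel]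
    rw [Measure.lintegral_compProd hf, hfst,
      lintegral_map hf.lintegral_kernel_prod_right' hΦ]
    rfl
  have hm : Measurable fun z : X × E => (z.2, Φ' z.1) := by fun_prop
  have hc : (σ.map fun z => (z.2, Φ' z.1)).map Prod.fst = μ ∧
      (σ.map fun z => (z.2, Φ' z.1)).map Prod.snd = ρ.map Φ' := by
    constructor
    · rw [Measure.map_map measurable_fst hm, ← hπ.1]
      have : π.map Prod.fst = π'.map Prod.snd := by
        rw [Measure.map_map measurable_snd measurable_swap]; rfl
      rw [this, ← hσ, Measure.map_map measurable_snd (hΦ.prodMap measurable_id)]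
      rfl
    · rw [Measure.map_map measurable_snd hm]
      have : ρ = σ.map Prod.fst := (Measure.fst_compProd ρ _).symm
      conv_rhs => rw [this, Measure.map_map hΦ' measurable_fst]
      rfl
  refine (iInf₂_le (σ.map fun z => (z.2, Φ' z.1)) hc).trans ?_
  rw [lintegral_map (by fun_prop) hm]
  have h1 : ∫⁻ z, edist z.1 z.2 ∂π = ∫⁻ z, edist z.2 (Φ z.1) ∂σ := by
    have : π = π'.map Prod.swap := by
      rw [Measure.map_map measurable_swap measurable_swap]; simp
    rw [this, ← hσ, Measure.map_map measurable_swap (hΦ.prodMap measurable_id),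
      lintegral_map (by fun_prop) (measurable_swap.comp (hΦ.prodMap measurable_id))]
    rfl
  have h2 : ∫⁻ x, edist (Φ x) (Φ' x) ∂ρ = ∫⁻ z, edist (Φ z.1) (Φ' z.1) ∂σ := by
    have : ρ = σ.map Prod.fst := (Measure.fst_compProd ρ _).symm
    conv_lhs => rw [this, lintegral_map (by fun_prop) measurable_fst]
  rw [h1, h2, ← lintegral_add_left (by fun_prop)]
  exact lintegral_mono fun z => edist_triangle _ _ _

lemma isCompact_cube (r : ℕ) :
    IsCompact {u : EuclideanSpace ℝ (Fin r) | ∀ i, u i ∈ Set.Icc (0 : ℝ) 1} := by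
  have := (isCompact_univ_pi fun _ : Fin r => isCompact_Icc (a := (0 : ℝ)) (b := 1)).image
    (PiLp.continuous_toLp 2 fun _ : Fin r => ℝ)
  convert this using 1
  ext u
  simp only [Set.mem_image, Set.mem_univ_pi]
  exact ⟨fun h => ⟨u.ofLp, h, rfl⟩, by rintro ⟨v, hv, rfl⟩; exact hv⟩

lemma ae_mem_cube (r : ℕ) : ∀ᵐ u ∂unifCube r, ∀ i, u i ∈ Set.Icc (0 : ℝ) 1 :=
  ae_restrict_mem (isCompact_cube r).measurableSet

/-- The product form yields both the total mass one and the uniform law of each coordinate. -/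
lemma unifCube_eq_map (r : ℕ) : unifCube r =
    (Measure.pi fun _ : Fin r => volume.restrict (Set.Icc (0 : ℝ) 1)).map (WithLp.toLp 2) := by
  have hp := EuclideanSpace.volume_preserving_symm_measurableEquiv_toLp (Fin r)
  have hp' := hp.symm
  rw [unifCube, ← hp'.map_eq, ← Measure.restrict_pi_pi, ← volume_pi]
  rw [MeasurableEquiv.restrict_map]
  congr 2
  ext v
  simp [Pi.le_def, forall_and]

instance isProbabilityMeasure_unifCube (r : ℕ) : IsProbabilityMeasure (unifCube r) := by
  have : IsProbabilityMeasure (volume.restrict (Set.Icc (0 : ℝ) 1)) := ⟨by simp⟩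
  rw [unifCube_eq_map]
  exact Measure.isProbabilityMeasure_map (by fun_prop)

/-- The radius is chosen before the probability space and the variable, so that it serves all input
laws at once. -/
lemma exists_block_bound {ι κ : Type} [Fintype κ]
    {f : EuclideanSpace ℝ ι → EuclideanSpace ℝ ι → EuclideanSpace ℝ κ}
    (hf : Continuous (Function.uncurry f)) {K : Set (EuclideanSpace ℝ ι)} (hK : IsCompact K) :
    ∃ R : ℝ, ∀ {Z : Type} [MeasurableSpace Z] (ρ : Measure Z) [IsProbabilityMeasure ρ]
      {W : Z → EuclideanSpace ℝ ι}, (∀ᵐ z ∂ρ, W z ∈ K) →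
      ∀ᵐ z ∂ρ, ∫ z', f (W z) (W z') ∂ρ ∈ Metric.closedBall 0 R := by
  obtain ⟨R, hR⟩ := (hK.prod hK).exists_bound_of_continuousOn hf.continuousOn
  refine ⟨R, fun ρ _ W hW => ?_⟩
  filter_upwards [hW] with z hz
  rw [mem_closedBall_zero_iff]
  refine (norm_integral_le_of_norm_le_const (C := R) ?_).trans (by simp)
  filter_upwards [hW] with z' hz' using hR (W z, W z') ⟨hz, hz'⟩

section Blocks

variable {ι κ : Type} [Fintype ι] [Fintype κ]

lemma measurable_integral_pair {Z : Type} [MeasurableSpace Z] (ρ : Measure Z) [SFinite ρ]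
    {f : EuclideanSpace ℝ ι → EuclideanSpace ℝ ι → EuclideanSpace ℝ κ}
    (hf : Continuous (Function.uncurry f)) {W : Z → EuclideanSpace ℝ ι} (hW : Measurable W) :
    Measurable fun z => ∫ z', f (W z) (W z') ∂ρ := by
  have h : StronglyMeasurable fun p : Z × Z => f (W p.1) (W p.2) :=
    (hf.measurable.comp ((hW.comp measurable_fst).prodMk
      (hW.comp measurable_snd))).stronglyMeasurable
  exact h.integral_prod_right.measurable

/-- A block applied to the law of `W`. -/
lemma block_map {Z : Type} [MeasurableSpace Z] (ρ : Measure Z) [IsFiniteMeasure ρ]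
    {f : EuclideanSpace ℝ ι → EuclideanSpace ℝ ι → EuclideanSpace ℝ κ}
    (hf : Continuous (Function.uncurry f)) {W : Z → EuclideanSpace ℝ ι} (hW : Measurable W) :
    block f (ρ.map W) = ρ.map fun z => ∫ z', f (W z) (W z') ∂ρ := by
  have h1 : ∀ y, ∫ x', f y x' ∂(ρ.map W) = ∫ z', f y (W z') ∂ρ := fun y =>
    integral_map hW.aemeasurable
      (hf.comp (Continuous.prodMk_right y)).measurable.aestronglyMeasurable
  have h2 : Measurable fun y => ∫ x', f y x' ∂(ρ.map W) :=
    measurable_integral_pair (ρ.map W) hf measurable_id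
  rw [block, Measure.map_map h2 hW]
  simp only [Function.comp_def, h1]

lemma addNoise_map {Z : Type} [MeasurableSpace Z] (ρ : Measure Z) [IsFiniteMeasure ρ]
    (r : ℕ) {W : Z → EuclideanSpace ℝ ι} (hW : Measurable W) :
    addNoise r (ρ.map W) = (ρ.prod (unifCube r)).map fun z => concat (W z.1) z.2 := by
  have := Measure.map_prod_map ρ (unifCube r) hW measurable_id
  rw [Measure.map_id] at this
  rw [addNoise, this, Measure.map_map continuous_concat.measurable (hW.prodMap measurable_id)]
  rfl

/-- If `f'` is uniformly close to `f` and `W'` to `W`, then so are the conditional expectations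
computed by the blocks. -/
lemma exists_block_modulus {f : EuclideanSpace ℝ ι → EuclideanSpace ℝ ι → EuclideanSpace ℝ κ}
    (hf : Continuous (Function.uncurry f)) {K : Set (EuclideanSpace ℝ ι)} (hK : IsCompact K)
    {η : ℝ} (hη : 0 < η) :
    ∃ (K' : Set (EuclideanSpace ℝ ι)) (δ : ℝ), IsCompact K' ∧ 0 < δ ∧
      ∀ f' : EuclideanSpace ℝ ι → EuclideanSpace ℝ ι → EuclideanSpace ℝ κ,
        Continuous (Function.uncurry f') → (∀ x ∈ K', ∀ x' ∈ K', ‖f x x' - f' x x'‖ ≤ δ) →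
        ∀ {Z : Type} [MeasurableSpace Z] (ρ : Measure Z) [IsProbabilityMeasure ρ]
          {W W' : Z → EuclideanSpace ℝ ι}, Measurable W → Measurable W' →
          (∀ᵐ z ∂ρ, W z ∈ K) → (∀ᵐ z ∂ρ, ‖W z - W' z‖ ≤ δ) →
          ∀ᵐ z ∂ρ, ‖∫ z', f (W z) (W z') ∂ρ - ∫ z', f' (W' z) (W' z') ∂ρ‖ ≤ η := by
  -- The perturbed variable `W'` may leave `K`, but it stays in the closed 1-neighbourhood as soon
  -- as `δ ≤ 1`.
  let K' := Metric.cthickening 1 K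
  have hK' : IsCompact K' := hK.cthickening
  have huc := (hK'.prod hK').uniformContinuousOn_of_continuous hf.continuousOn
  obtain ⟨δ₀, hδ₀, h₀⟩ := Metric.uniformContinuousOn_iff_le.1 huc (η / 2) (by positivity)
  -- The three bounds serve the uniform continuity of `f`, the inclusion in `K'`, and the error `η /
  -- 2` from replacing `f` by `f'`.
  refine ⟨K', min δ₀ (min 1 (η / 2)), hK', by positivity, ?_⟩
  intro f' hf' hff' Z _ ρ _ W W' hW hW' hWK hWW'
  have hmem : ∀ᵐ z ∂ρ, W z ∈ K' ∧ W' z ∈ K' ∧ dist (W z) (W' z) ≤ δ₀ := by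
    filter_upwards [hWK, hWW'] with z h1 h2
    rw [← dist_eq_norm] at h2
    refine ⟨Metric.self_subset_cthickening _ h1, ?_, h2.trans (min_le_left _ _)⟩
    refine Metric.mem_cthickening_of_dist_le _ _ _ _ h1 ?_
    rw [dist_comm]
    exact h2.trans ((min_le_right _ _).trans (min_le_left _ _))
  have hint : ∀ {k : EuclideanSpace ℝ ι → EuclideanSpace ℝ ι → EuclideanSpace ℝ κ}
      {V : Z → EuclideanSpace ℝ ι}, Continuous (Function.uncurry k) → Measurable V →
      (∀ᵐ z ∂ρ, V z ∈ K') → ∀ y, Integrable (fun z' => k y (V z')) ρ := by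
    intro k V hk hV hVK y
    have hky : Continuous (k y) := hk.comp (Continuous.prodMk_right y)
    obtain ⟨B, hB⟩ := hK'.exists_bound_of_continuousOn hky.continuousOn
    refine Integrable.of_bound (hky.measurable.comp hV).aestronglyMeasurable B ?_
    filter_upwards [hVK] with z hz using hB _ hz
  filter_upwards [hmem] with z hz
  rw [← integral_sub (hint hf hW (hmem.mono fun z h => h.1) _)
    (hint hf' hW' (hmem.mono fun z h => h.2.1) _)]
  refine (norm_integral_le_of_norm_le_const (C := η) ?_).trans (by simp)
  filter_upwards [hmem] with z' hz'
  have h1 : ‖f (W z) (W z') - f (W' z) (W' z')‖ ≤ η / 2 := by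
    rw [← dist_eq_norm]
    exact h₀ (W z, W z') ⟨hz.1, hz'.1⟩ (W' z, W' z') ⟨hz.2.1, hz'.2.1⟩
      (max_le hz.2.2 hz'.2.2)
  have h2 : ‖f (W' z) (W' z') - f' (W' z) (W' z')‖ ≤ η / 2 :=
    (hff' _ hz.2.1 _ hz'.2.1).trans ((min_le_right _ _).trans (min_le_right _ _))
  calc _ ≤ _ := norm_sub_le_norm_sub_add_norm_sub _ (f (W' z) (W' z')) _
    _ ≤ η := by linarith

lemma norm_concat_sub_concat_right (x x' : EuclideanSpace ℝ ι) (y : EuclideanSpace ℝ κ) :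
    ‖concat x y - concat x' y‖ = ‖x - x'‖ := by
  simp [EuclideanSpace.norm_eq, concat]

end Blocks

section Architecture

variable {q n m r : ℕ}
  {f f' : EuclideanSpace ℝ (Fin q) → EuclideanSpace ℝ (Fin q) → EuclideanSpace ℝ (Fin n)}
  {g g' : EuclideanSpace ℝ (Fin n) → EuclideanSpace ℝ (Fin n) → EuclideanSpace ℝ (Fin m)}
  {h h' : EuclideanSpace ℝ (Fin m ⊕ Fin r) → EuclideanSpace ℝ (Fin m ⊕ Fin r) →
      EuclideanSpace ℝ (Fin r)}

/-- The input of the last block, as a function of the input and of the noise. -/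
noncomputable def latent (f : EuclideanSpace ℝ (Fin q) → EuclideanSpace ℝ (Fin q) → EuclideanSpace ℝ (Fin n))
    (g : EuclideanSpace ℝ (Fin n) → EuclideanSpace ℝ (Fin n) → EuclideanSpace ℝ (Fin m))
    (α : Measure (EuclideanSpace ℝ (Fin q)))
    (z : EuclideanSpace ℝ (Fin q) × EuclideanSpace ℝ (Fin r)) : EuclideanSpace ℝ (Fin m ⊕ Fin r) :=
  concat (∫ x', g (∫ y, f z.1 y ∂α) (∫ y, f x' y ∂α) ∂α) z.2

lemma measurable_latent (hf : Continuous (Function.uncurry f)) (hg : Continuous (Function.uncurry g))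
    (α : Measure (EuclideanSpace ℝ (Fin q))) [IsFiniteMeasure α] :
    Measurable (latent (r := r) f g α) := by
  have h1 := measurable_integral_pair α hf measurable_id
  have h2 := measurable_integral_pair α hg h1
  exact continuous_concat.measurable.comp ((h2.comp measurable_fst).prodMk measurable_snd)

/-- Realizing all blocks on the one probability space of input and noise makes architectures with
different maps push-forwards of a common measure. -/
lemma architecture_eq_map (hf : Continuous (Function.uncurry f))
    (hg : Continuous (Function.uncurry g)) (hh : Continuous (Function.uncurry h))
    (α : Measure (EuclideanSpace ℝ (Fin q))) [IsFiniteMeasure α] :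
    architecture f g h α = (α.prod (unifCube r)).map fun z =>
      ∫ z', h (latent f g α z) (latent f g α z') ∂(α.prod (unifCube r)) := by
  have h1 : Measurable fun x => ∫ y, f x y ∂α := measurable_integral_pair α hf measurable_id
  have h2 := measurable_integral_pair α hg h1
  rw [architecture]
  have e1 : block f α = α.map fun x => ∫ y, f x y ∂α := rfl
  rw [e1, block_map α hg h1, addNoise_map α r h2]
  exact block_map (α.prod (unifCube r)) hh (measurable_latent hf hg α)

instance isProbabilityMeasure_toAmbient {K : Set (EuclideanSpace ℝ (Fin q))}
    (α : ProbabilityMeasure K) : IsProbabilityMeasure (toAmbient α) :=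
  Measure.isProbabilityMeasure_map (by fun_prop)

lemma ae_mem_toAmbient {K : Set (EuclideanSpace ℝ (Fin q))} (hK : IsCompact K)
    (α : ProbabilityMeasure K) : ∀ᵐ x ∂toAmbient α, x ∈ K := by
  refine (ae_map_iff (p := (· ∈ K)) (by fun_prop) (by simpa using hK.measurableSet)).2 ?_
  exact Eventually.of_forall fun x => x.2

/-- The architecture depends continuously on its maps, uniformly in the input law. -/
theorem exists_isPairNet_architecture_approx {lam : ℝ → ℝ} (hcont : Continuous lam)
    (hbdd : ∃ M : ℝ, ∀ t, |lam t| ≤ M) (hne : ∃ s t, lam s ≠ lam t)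
    {X : Set (EuclideanSpace ℝ (Fin q))} (hX : IsCompact X)
    (hf : Continuous (Function.uncurry f)) (hg : Continuous (Function.uncurry g))
    (hh : Continuous (Function.uncurry h)) {δ : ℝ} (hδ : 0 < δ) :
    ∃ (f' : EuclideanSpace ℝ (Fin q) → EuclideanSpace ℝ (Fin q) → EuclideanSpace ℝ (Fin n))
      (g' : EuclideanSpace ℝ (Fin n) → EuclideanSpace ℝ (Fin n) → EuclideanSpace ℝ (Fin m))
      (h' : EuclideanSpace ℝ (Fin m ⊕ Fin r) → EuclideanSpace ℝ (Fin m ⊕ Fin r) →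
        EuclideanSpace ℝ (Fin r)),
      IsPairNet lam f' ∧ IsPairNet lam g' ∧ IsPairNet lam h' ∧
      ∀ (α : ProbabilityMeasure X) (μ : Measure (EuclideanSpace ℝ (Fin r))),
        W1 μ (architecture f' g' h' (toAmbient α)) ≤
          W1 μ (architecture f g h (toAmbient α)) + ENNReal.ofReal δ := by
  obtain ⟨Rf, hRf⟩ := exists_block_bound hf hX
  obtain ⟨Rg, hRg⟩ := exists_block_bound hg (isCompact_closedBall 0 Rf)
  have hKh := ((isCompact_closedBall (0 : EuclideanSpace ℝ (Fin m)) Rg).prod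
    (isCompact_cube r)).image continuous_concat
  -- Tolerances are chosen from the last block backwards: the input error allowed for one block is
  -- the output error demanded of the block before it.
  obtain ⟨Kh, δh, hKh', hδh, Hh⟩ := exists_block_modulus hh hKh hδ
  obtain ⟨Kg, δg, hKg', hδg, Hg⟩ := exists_block_modulus hg (isCompact_closedBall 0 Rf) hδh
  obtain ⟨Kf, δf, hKf', hδf, Hf⟩ := exists_block_modulus hf hX hδg
  obtain ⟨f', hf', hff'⟩ := exists_isPairNet_approx hcont hbdd hne hKf' hf hδf
  obtain ⟨g', hg', hgg'⟩ := exists_isPairNet_approx hcont hbdd hne hKg' hg hδg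
  obtain ⟨h', hh', hhh'⟩ := exists_isPairNet_approx hcont hbdd hne hKh' hh hδh
  refine ⟨f', g', h', hf', hg', hh', fun α μ => ?_⟩
  have cf' := hf'.continuous hcont
  have cg' := hg'.continuous hcont
  have ch' := hh'.continuous hcont
  set β := toAmbient α with hβ
  have hβX : ∀ᵐ x ∂β, x ∈ X := ae_mem_toAmbient hX α
  have m1 := measurable_integral_pair β hf measurable_id
  have m1' := measurable_integral_pair β cf' measurable_id
  -- The first block receives the same input in both architectures, so its input error is zero.
  have af := Hf f' cf' hff' β measurable_id measurable_id hβX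
    (Eventually.of_forall fun z => by simpa using hδf.le)
  have ag := Hg g' cg' hgg' β m1 m1' (hRf β hβX) af
  have bg := hRg β (hRf β hβX)
  have q1 := (Measure.quasiMeasurePreserving_fst (μ := β) (ν := unifCube r))
  have q2 := (Measure.quasiMeasurePreserving_snd (μ := β) (ν := unifCube r))
  have ah := Hh h' ch' hhh' (β.prod (unifCube r)) (measurable_latent hf hg β)
    (measurable_latent cf' cg' β)
    (by
      filter_upwards [q1.ae bg, q2.ae (ae_mem_cube r)] with z hz hz'
      exact Set.mem_image_of_mem _ (Set.mk_mem_prod hz (Set.mem_ofPred.2 hz')))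
    (by
      filter_upwards [q1.ae ag] with z hz
      rw [latent, latent, norm_concat_sub_concat_right]
      exact hz)
  rw [architecture_eq_map hf hg hh, architecture_eq_map cf' cg' ch']
  refine (W1_map_le_add μ (β.prod (unifCube r))
    (measurable_integral_pair (β.prod (unifCube r)) hh (measurable_latent hf hg β))
    (measurable_integral_pair (β.prod (unifCube r)) ch' (measurable_latent cf' cg' β))).trans ?_
  gcongr
  calc _ ≤ ∫⁻ _, ENNReal.ofReal δ ∂(β.prod (unifCube r)) := by
        refine lintegral_mono_ae ?_
        filter_upwards [ah] with z hz
        rw [edist_dist, dist_eq_norm]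
        exact ENNReal.ofReal_le_ofReal hz
    _ = ENNReal.ofReal δ := by simp

end Architecture

/-! ### Quantization of measures and simulation of discrete laws. -/

section Quantize

variable {r k : ℕ}

/-- A compact set has continuous partitions of unity with small supports. -/
lemma exists_partition {Y : Set (EuclideanSpace ℝ (Fin r))} (hY : IsCompact Y) {ε : ℝ}
    (hε : 0 < ε) :
    ∃ (k : ℕ) (y : Fin k → EuclideanSpace ℝ (Fin r)) (φ : Fin k → C(Y, ℝ)),
      (∀ i x, 0 ≤ φ i x) ∧ (∀ x, ∑ i, φ i x = 1) ∧ ∀ i x, φ i x ≠ 0 → dist x.1 (y i) ≤ ε := by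
  obtain ⟨t, -, hfin, ht⟩ := hY.finite_cover_balls hε
  let e := hfin.toFinset.equivFin
  let y : Fin hfin.toFinset.card → EuclideanSpace ℝ (Fin r) := fun i => (e.symm i).1
  -- Tent functions supported in the balls of a finite cover; at each point of `Y` at least one is
  -- positive, so their sum can be divided out.
  let ψ : Fin hfin.toFinset.card → Y → ℝ := fun i x => max 0 (ε - dist x.1 (y i))
  have hψc : ∀ i, Continuous (ψ i) := fun i => by fun_prop
  have hψ0 : ∀ i x, 0 ≤ ψ i x := fun i x => le_max_left _ _
  have hpos : ∀ x, 0 < ∑ i, ψ i x := by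
    intro x
    obtain ⟨c, hc, hxc⟩ := Set.mem_iUnion₂.1 (ht x.2)
    refine Finset.sum_pos' (fun i _ => hψ0 i x)
      ⟨e ⟨c, hfin.mem_toFinset.2 hc⟩, Finset.mem_univ _, ?_⟩
    simp only [ψ, y, Equiv.symm_apply_apply, lt_max_iff]
    right
    simpa using hxc
  refine ⟨_, y, fun i => ⟨fun x => ψ i x / ∑ j, ψ j x,
    (hψc i).div (continuous_finsetSum _ fun j _ => hψc j) fun x => (hpos x).ne'⟩,
    fun i x => div_nonneg (hψ0 i x) (hpos x).le, fun x => ?_, fun i x hx => ?_⟩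
  · simp only [ContinuousMap.coe_mk]
    rw [← Finset.sum_div, div_self (hpos x).ne']
  · by_contra! h
    apply hx
    have : ψ i x = 0 := max_eq_left (by linarith)
    simp [this]

/-- A measure is close to its quantization by a partition of unity with small supports. -/
lemma W1_quantize_le {Y : Set (EuclideanSpace ℝ (Fin r))} (P : ProbabilityMeasure Y)
    (hY : IsCompact Y) (y : Fin k → EuclideanSpace ℝ (Fin r)) (φ : Fin k → C(Y, ℝ))
    (h0 : ∀ i x, 0 ≤ φ i x) (h1 : ∀ x, ∑ i, φ i x = 1) {ε : ℝ}
    (hε : ∀ i x, φ i x ≠ 0 → dist x.1 (y i) ≤ ε) :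
    W1 (toAmbient P) (∑ i, ENNReal.ofReal (∫ x, φ i x ∂(P : Measure Y)) • Measure.dirac (y i)) ≤
      ENNReal.ofReal ε := by
  have : CompactSpace Y := isCompact_iff_compactSpace.1 hY
  have hsum : ∀ x, ∑ i, ENNReal.ofReal (φ i x) = 1 := fun x => by
    rw [← ENNReal.ofReal_sum_of_nonneg fun i _ => h0 i x, h1, ENNReal.ofReal_one]
  have hm : ∀ i, Measurable fun x => ENNReal.ofReal (φ i x) := fun i =>
    ENNReal.measurable_ofReal.comp (φ i).continuous.measurable
  have hpair : ∀ i, Measurable fun x : Y => (x.1, y i) := fun i => by fun_prop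
  -- The coupling splits the mass at `x` into portions `φ i x` and sends the `i`-th to `y i`, at
  -- distance at most `ε` whenever the portion is nonzero.
  let π : Measure (EuclideanSpace ℝ (Fin r) × EuclideanSpace ℝ (Fin r)) :=
    ∑ i, ((P : Measure Y).withDensity fun x => ENNReal.ofReal (φ i x)).map fun x => (x.1, y i)
  have hπ : ∀ f : EuclideanSpace ℝ (Fin r) × EuclideanSpace ℝ (Fin r) → ENNReal, Measurable f →
      ∫⁻ z, f z ∂π = ∑ i, ∫⁻ x, ENNReal.ofReal (φ i x) * f (x.1, y i) ∂(P : Measure Y) := by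
    intro f hf
    rw [lintegral_finsetSum_measure]
    refine Finset.sum_congr rfl fun i _ => ?_
    rw [lintegral_map hf (hpair i)]
    exact lintegral_withDensity_eq_lintegral_mul _ (hm i) (hf.comp (hpair i))
  refine (iInf₂_le π ⟨?_, ?_⟩).trans ?_
  · rw [hπ _ (by fun_prop)]
    calc _ ≤ ∑ i, ∫⁻ x, ENNReal.ofReal (φ i x) * ENNReal.ofReal ε ∂(P : Measure Y) := by
          refine Finset.sum_le_sum fun i _ => lintegral_mono fun x => ?_
          by_cases hx : φ i x = 0
          · simp [hx]
          · gcongr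
            rw [edist_dist]
            exact ENNReal.ofReal_le_ofReal (hε i x hx)
      _ = ENNReal.ofReal ε := by
          rw [← lintegral_finsetSum _ fun i _ => (hm i).mul_const _]
          simp only [← Finset.sum_mul, hsum, one_mul]
          simp
  · refine Measure.ext_of_lintegral _ fun f hf => ?_
    rw [lintegral_map hf measurable_fst, hπ (fun z => f z.1) (hf.comp measurable_fst), toAmbient,
      lintegral_map hf measurable_subtype_coe, ← lintegral_finsetSum]
    · simp only [← Finset.sum_mul, hsum, one_mul]
    · exact fun i _ => (hm i).mul (hf.comp measurable_subtype_coe)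
  · refine Measure.ext_of_lintegral _ fun f hf => ?_
    rw [lintegral_map hf measurable_snd, hπ (fun z => f z.2) (hf.comp measurable_snd),
      lintegral_finsetSum_measure]
    refine Finset.sum_congr rfl fun i _ => ?_
    dsimp only
    rw [lintegral_mul_const _ (hm i), lintegral_smul_measure, lintegral_dirac' _ hf,
      ofReal_integral_eq_lintegral_ofReal
        ((φ i).continuous.integrable_of_hasCompactSupport (HasCompactSupport.of_compactSpace _))
        (Eventually.of_forall fun x => h0 i x), smul_eq_mul]

/-- The partial sums of a finite sequence. -/
def partialSum (p : EuclideanSpace ℝ (Fin k)) (i : ℕ) : ℝ :=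
  ∑ j ∈ Finset.univ.filter (fun j : Fin k => j.1 < i), p j

lemma partialSum_zero (p : EuclideanSpace ℝ (Fin k)) : partialSum p 0 = 0 := by simp [partialSum]

lemma partialSum_last (p : EuclideanSpace ℝ (Fin k)) : partialSum p k = ∑ j, p j := by
  simp [partialSum]

lemma partialSum_succ (p : EuclideanSpace ℝ (Fin k)) (i : Fin k) :
    partialSum p (i + 1) = partialSum p i + p i := by
  have : Finset.univ.filter (fun j : Fin k => j.1 < i.1 + 1) =
      insert i (Finset.univ.filter (fun j : Fin k => j.1 < i.1)) := by
    ext j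
    simp only [Finset.mem_filter, Finset.mem_univ, true_and, Finset.mem_insert, Fin.ext_iff]
    omega
  rw [partialSum, this, Finset.sum_insert (by simp), add_comm]
  rfl

lemma monotone_partialSum {p : EuclideanSpace ℝ (Fin k)} (hp : ∀ i, 0 ≤ p i) :
    Monotone (partialSum p) := by
  intro a b hab
  refine Finset.sum_le_sum_of_subset_of_nonneg (fun j hj => ?_) fun j _ _ => hp j
  simp only [Finset.mem_filter, Finset.mem_univ, true_and] at hj ⊢
  omega

lemma exists_mem_Ico_partialSum {p : EuclideanSpace ℝ (Fin k)} {t : ℝ} (h0 : 0 ≤ t)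
    (h1 : t < ∑ j, p j) :
    ∃ i : Fin k, t ∈ Set.Ico (partialSum p i) (partialSum p (i + 1)) := by
  classical
  -- The first partial sum exceeding `t` has a nonzero index because the empty sum is `0 ≤ t`; the
  -- interval sought ends there.
  have hex : ∃ i, t < partialSum p i := ⟨k, by rwa [partialSum_last]⟩
  have hk : Nat.find hex ≤ k := Nat.find_min' hex (by rwa [partialSum_last])
  have hpos : Nat.find hex ≠ 0 := by
    intro h
    have := Nat.find_spec hex
    rw [h, partialSum_zero] at this
    linarith
  obtain ⟨i, hi⟩ := Nat.exists_eq_succ_of_ne_zero hpos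
  refine ⟨⟨i, by omega⟩, not_lt.1 (Nat.find_min hex (m := i) (by omega)), ?_⟩
  have := Nat.find_spec hex
  rwa [hi] at this

/-- The step function with value `y i` on an interval of length `p i`. -/
noncomputable def stepMap (y : Fin k → EuclideanSpace ℝ (Fin r)) (p : EuclideanSpace ℝ (Fin k))
    (t : ℝ) : EuclideanSpace ℝ (Fin r) :=
  ∑ i : Fin k, (Set.Ico (partialSum p i) (partialSum p (i + 1))).indicator (fun _ => (1 : ℝ)) t • y i

lemma measurable_stepMap (y : Fin k → EuclideanSpace ℝ (Fin r)) (p : EuclideanSpace ℝ (Fin k)) :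
    Measurable (stepMap y p) :=
  Finset.measurable_fun_sum _ fun _ _ =>
    (measurable_const.indicator measurableSet_Ico).smul_const _

/-- The law of a step function of a uniform variable. -/
lemma map_stepMap (y : Fin k → EuclideanSpace ℝ (Fin r)) {p : EuclideanSpace ℝ (Fin k)}
    (hp : ∀ i, 0 ≤ p i) (hp1 : ∑ i, p i = 1) :
    (volume.restrict (Set.Icc (0 : ℝ) 1)).map (stepMap y p) =
      ∑ i, ENNReal.ofReal (p i) • Measure.dirac (y i) := by
  refine Measure.ext_of_lintegral _ fun f hf => ?_
  -- The endpoint `1` lies in none of the half-open intervals, so it is discarded as a null set.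
  rw [lintegral_map hf (measurable_stepMap y p), ← restrict_Ico_eq_restrict_Icc]
  have hmono := monotone_partialSum hp
  have key : ∀ t ∈ Set.Ico (0 : ℝ) 1, f (stepMap y p t) =
      ∑ i : Fin k, (Set.Ico (partialSum p i) (partialSum p (i + 1))).indicator
        (fun _ => f (y i)) t := by
    intro t ht
    obtain ⟨i, hi⟩ := exists_mem_Ico_partialSum (p := p) ht.1 (by rw [hp1]; exact ht.2)
    have hne : ∀ j : Fin k, j ≠ i → t ∉ Set.Ico (partialSum p j) (partialSum p (j + 1)) := by
      intro j hj hjt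
      rcases lt_or_gt_of_ne hj with h | h
      · have := hmono (show j.1 + 1 ≤ i.1 from h)
        linarith [hjt.2, hi.1]
      · have := hmono (show i.1 + 1 ≤ j.1 from h)
        linarith [hjt.1, hi.2]
    rw [stepMap, Finset.sum_eq_single i, Finset.sum_eq_single i]
    · simp [hi]
    · exact fun j _ hj => Set.indicator_of_notMem (hne j hj) _
    · simp
    · exact fun j _ hj => by rw [Set.indicator_of_notMem (hne j hj), zero_smul]
    · simp
  rw [setLIntegral_congr_fun measurableSet_Ico key, lintegral_finsetSum _ fun i _ =>
    measurable_const.indicator measurableSet_Ico, lintegral_finsetSum_measure]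
  refine Finset.sum_congr rfl fun i _ => ?_
  rw [lintegral_indicator_const measurableSet_Ico, lintegral_smul_measure, lintegral_dirac' _ hf,
    Measure.restrict_apply measurableSet_Ico, Set.inter_eq_left.2, Real.volume_Ico,
    partialSum_succ, add_sub_cancel_left, mul_comm, smul_eq_mul]
  refine Set.Ico_subset_Ico ?_ ?_
  · exact (partialSum_zero p).symm.le.trans (hmono (Nat.zero_le _))
  · exact (hmono (show i.1 + 1 ≤ k from i.2)).trans (by rw [partialSum_last, hp1])

/-- The continuous ramp between `0` and `1`. -/
noncomputable def ramp (t : ℝ) : ℝ := max 0 (min 1 t)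

@[fun_prop]
lemma continuous_ramp : Continuous ramp := by unfold ramp; fun_prop

/-- A continuous approximation of the step function. -/
noncomputable def rampMap (η : ℝ) (y : Fin k → EuclideanSpace ℝ (Fin r))
    (z : EuclideanSpace ℝ (Fin k) × ℝ) : EuclideanSpace ℝ (Fin r) :=
  ∑ i : Fin k, (ramp ((partialSum z.1 (i + 1) - z.2) / η) -
    ramp ((partialSum z.1 i - z.2) / η)) • y i

lemma continuous_rampMap (η : ℝ) (y : Fin k → EuclideanSpace ℝ (Fin r)) :
    Continuous (rampMap η y) := by
  unfold rampMap partialSum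
  fun_prop

/-- The ramp is `1` for `t ≤ s - η` and `0` for `t ≥ s`, so the two functions differ only in
between, and there by at most `1`. -/
lemma abs_ramp_sub_indicator_le {η : ℝ} (hη : 0 < η) (s t : ℝ) :
    |ramp ((s - t) / η) - (Set.Iio s).indicator (fun _ => (1 : ℝ)) t| ≤
      (Set.Ioo (s - η) s).indicator (fun _ => (1 : ℝ)) t := by
  by_cases h1 : t < s
  · have hpos : 0 ≤ (s - t) / η := div_nonneg (by linarith) hη.le
    rw [Set.indicator_of_mem (show t ∈ Set.Iio s from h1)]
    by_cases h2 : s - η < t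
    · rw [Set.indicator_of_mem (show t ∈ Set.Ioo (s - η) s from ⟨h2, h1⟩), ramp,
        max_eq_right (le_min zero_le_one hpos), abs_le]
      have := min_le_left (1 : ℝ) ((s - t) / η)
      have := le_min zero_le_one hpos
      constructor <;> linarith
    · have : 1 ≤ (s - t) / η := by rw [le_div_iff₀ hη]; linarith
      rw [ramp, min_eq_left this, max_eq_right zero_le_one, sub_self, abs_zero]
      exact Set.indicator_nonneg (fun _ _ => zero_le_one) _
  · have hneg : (s - t) / η ≤ 0 := div_nonpos_of_nonpos_of_nonneg (by linarith) hη.le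
    rw [Set.indicator_of_notMem (show t ∉ Set.Iio s from h1), ramp,
      max_eq_left ((min_le_right _ _).trans hneg), sub_zero, abs_zero]
    exact Set.indicator_nonneg (fun _ _ => zero_le_one) _

lemma indicator_Ico_eq_sub {a b : ℝ} (hab : a ≤ b) (t : ℝ) :
    (Set.Ico a b).indicator (fun _ => (1 : ℝ)) t =
      (Set.Iio b).indicator (fun _ => (1 : ℝ)) t - (Set.Iio a).indicator (fun _ => (1 : ℝ)) t := by
  by_cases h1 : t < a
  · have h2 : t < b := h1.trans_le hab
    simp [Set.indicator, h1.not_ge, h1, h2]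
  · by_cases h2 : t < b
    · simp [Set.indicator, not_lt.1 h1, h1, h2]
    · simp [Set.indicator, h1, h2]

/-- Each interval indicator is a difference of two half-line indicators; smoothing each of them
costs at most `η` in mean, whence `η + η` per value `y i`. -/
lemma lintegral_edist_stepMap_rampMap_le {η : ℝ} (hη : 0 < η)
    (y : Fin k → EuclideanSpace ℝ (Fin r)) {p : EuclideanSpace ℝ (Fin k)} (hp : ∀ i, 0 ≤ p i) :
    ∫⁻ t in Set.Icc (0 : ℝ) 1, edist (stepMap y p t) (rampMap η y (p, t)) ≤
      ENNReal.ofReal (∑ i, ‖y i‖ * (η + η)) := by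
  let B : ℝ → ℝ → ℝ := fun s => (Set.Ioo (s - η) s).indicator fun _ => (1 : ℝ)
  have hB0 : ∀ s t, 0 ≤ B s t := fun s t => Set.indicator_nonneg (fun _ _ => zero_le_one) _
  have hBm : ∀ s, Measurable (B s) := fun s => measurable_const.indicator measurableSet_Ioo
  have hpt : ∀ t, edist (stepMap y p t) (rampMap η y (p, t)) ≤
      ∑ i : Fin k, ENNReal.ofReal ‖y i‖ *
        (ENNReal.ofReal (B (partialSum p (i + 1)) t) + ENNReal.ofReal (B (partialSum p i) t)) := by
    intro t
    have h1 : dist (stepMap y p t) (rampMap η y (p, t)) ≤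
        ∑ i : Fin k, ‖y i‖ * (B (partialSum p (i + 1)) t + B (partialSum p i) t) := by
      rw [dist_comm, dist_eq_norm, stepMap, rampMap, ← Finset.sum_sub_distrib]
      refine (norm_sum_le _ _).trans (Finset.sum_le_sum fun i _ => ?_)
      rw [← sub_smul, norm_smul, mul_comm, Real.norm_eq_abs,
        indicator_Ico_eq_sub (monotone_partialSum hp (Nat.le_succ _)), sub_sub_sub_comm]
      gcongr
      exact (abs_sub _ _).trans (add_le_add (abs_ramp_sub_indicator_le hη _ _)
        (abs_ramp_sub_indicator_le hη _ _))
    rw [edist_dist]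
    refine (ENNReal.ofReal_le_ofReal h1).trans_eq ?_
    rw [ENNReal.ofReal_sum_of_nonneg fun i _ =>
      mul_nonneg (norm_nonneg _) (add_nonneg (hB0 _ _) (hB0 _ _))]
    refine Finset.sum_congr rfl fun i _ => ?_
    rw [ENNReal.ofReal_mul (norm_nonneg _), ENNReal.ofReal_add (hB0 _ _) (hB0 _ _)]
  have hBi : ∀ s, ∫⁻ t in Set.Icc (0 : ℝ) 1, ENNReal.ofReal (B s t) ≤ ENNReal.ofReal η := by
    intro s
    have : (fun t => ENNReal.ofReal (B s t)) = (Set.Ioo (s - η) s).indicator fun _ => 1 := by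
      ext t
      by_cases ht : t ∈ Set.Ioo (s - η) s
      · simp only [B, Set.indicator_of_mem ht, ENNReal.ofReal_one]
      · simp only [B, Set.indicator_of_notMem ht, ENNReal.ofReal_zero]
    rw [this, lintegral_indicator_const measurableSet_Ioo, one_mul]
    refine (Measure.restrict_apply_le _ _).trans ?_
    rw [Real.volume_Ioo, sub_sub_cancel]
  have hm : ∀ s, Measurable fun t => ENNReal.ofReal (B s t) := fun s =>
    ENNReal.measurable_ofReal.comp (hBm s)
  have hm2 : ∀ s s', Measurable fun t => ENNReal.ofReal (B s t) + ENNReal.ofReal (B s' t) :=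
    fun s s' => (hm s).add (hm s')
  refine (lintegral_mono hpt).trans ?_
  rw [lintegral_finsetSum _ fun i _ => (hm2 _ _).const_mul _,
    ENNReal.ofReal_sum_of_nonneg fun i _ => by positivity]
  refine Finset.sum_le_sum fun i _ => ?_
  rw [lintegral_const_mul _ (hm2 _ _), lintegral_add_left (hm _),
    ENNReal.ofReal_mul (norm_nonneg _), ENNReal.ofReal_add hη.le hη.le]
  gcongr <;> exact hBi _

end Quantize

/-! ### Assembling the architecture. -/

lemma map_eval_unifCube {r : ℕ} (i : Fin r) :
    (unifCube r).map (fun u => u i) = volume.restrict (Set.Icc (0 : ℝ) 1) := by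
  have : IsProbabilityMeasure (volume.restrict (Set.Icc (0 : ℝ) 1)) := ⟨by simp⟩
  rw [unifCube_eq_map, Measure.map_map (by fun_prop) (by fun_prop)]
  exact (measurePreserving_eval (fun _ : Fin r => volume.restrict (Set.Icc (0 : ℝ) 1)) i).map_eq

/-- Every continuous map between spaces of probability measures on compact sets is approximated
by the architecture with continuous maps, if there is at least one noise variable. -/
lemma exists_continuous_architecture_approx_of_pos {lam : ℝ → ℝ} (hcont : Continuous lam)
    (hbdd : ∃ M : ℝ, ∀ t, |lam t| ≤ M) (hne : ∃ s t, lam s ≠ lam t) {q r : ℕ} (i₀ : Fin r)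
    {X : Set (EuclideanSpace ℝ (Fin q))} {Y : Set (EuclideanSpace ℝ (Fin r))}
    (hX : IsCompact X) (hY : IsCompact Y) {F : ProbabilityMeasure X → ProbabilityMeasure Y}
    (hF : Continuous F) {ε : ℝ} (hε : 0 < ε) :
    ∃ (n m : ℕ)
      (f : EuclideanSpace ℝ (Fin q) → EuclideanSpace ℝ (Fin q) → EuclideanSpace ℝ (Fin n))
      (g : EuclideanSpace ℝ (Fin n) → EuclideanSpace ℝ (Fin n) → EuclideanSpace ℝ (Fin m))
      (h : EuclideanSpace ℝ (Fin m ⊕ Fin r) → EuclideanSpace ℝ (Fin m ⊕ Fin r) →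
        EuclideanSpace ℝ (Fin r)),
      Continuous (Function.uncurry f) ∧ Continuous (Function.uncurry g) ∧
      Continuous (Function.uncurry h) ∧
      ∀ α : ProbabilityMeasure X,
        W1 (toAmbient (F α)) (architecture f g h (toAmbient α)) ≤ ENNReal.ofReal ε := by
  have hε3 : 0 < ε / 3 := by positivity
  obtain ⟨k, y, φ, hφ0, hφ1, hφε⟩ := exists_partition hY hε3
  have : CompactSpace Y := isCompact_iff_compactSpace.1 hY
  let p : ProbabilityMeasure X → EuclideanSpace ℝ (Fin k) := fun α =>
    WithLp.toLp 2 fun i => ∫ x, φ i x ∂(F α : Measure Y)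
  have hp0 : ∀ α i, 0 ≤ p α i := fun α i => integral_nonneg fun x => hφ0 i x
  have hp1 : ∀ α, ∑ i, p α i = 1 := by
    intro α
    simp only [p]
    rw [← integral_finsetSum _ fun i _ => (φ i).continuous.integrable_of_hasCompactSupport
      (HasCompactSupport.of_compactSpace _)]
    simp [hφ1]
  have hpc : ∀ i, Continuous fun α => p α i := fun i =>
    (ProbabilityMeasure.continuous_integral_continuousMap (φ i)).comp hF
  obtain ⟨η, hη, hηε⟩ : ∃ η : ℝ, 0 < η ∧ ∑ i, ‖y i‖ * (η + η) ≤ ε / 3 := by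
    have hS : 0 ≤ ∑ i, ‖y i‖ := Finset.sum_nonneg fun _ _ => norm_nonneg _
    -- The summand `1` keeps the denominator positive when all `y i` vanish.
    refine ⟨ε / 6 / (1 + ∑ i, ‖y i‖), by positivity, ?_⟩
    rw [← Finset.sum_mul, ← add_div, ← mul_div_assoc, div_le_iff₀ (by positivity)]
    nlinarith
  -- Radius `2` suffices: the weight vector has norm at most `1`, and its approximation will be
  -- within `min δ 1` of it.
  have huc := ((isCompact_closedBall (0 : EuclideanSpace ℝ (Fin k)) 2).prod
    (isCompact_Icc (a := (0 : ℝ)) (b := 1))).uniformContinuousOn_of_continuous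
    (continuous_rampMap η y).continuousOn
  obtain ⟨δ, hδ, hδε⟩ := Metric.uniformContinuousOn_iff_le.1 huc (ε / 3) hε3
  have hδ' : 0 < min δ 1 := by positivity
  obtain ⟨n, A, b, G, hG, hGp⟩ := exists_encoder_approx hcont hbdd hne hX
    (fun i α => p α i) hpc (ε := min δ 1 / (Fintype.card (Fin k) + 1)) (by positivity)
  have hGd : ∀ α, dist (p α) (G (∫ x : X, fcNet lam A b 1 x.1 ∂(α : Measure X))) ≤ min δ 1 := by
    intro α
    rw [dist_eq_norm]
    exact euclidean_norm_le_of_forall_abs_le _ hδ'.le fun i => (hGp α i).le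
  -- Since `f` ignores its first argument, `T_f` outputs a Dirac mass at the encoding of `α`; `g`
  -- moves it to the approximate weights, and `h` feeds these and one noise coordinate to the ramp
  -- map. The ramp map is continuous for arbitrary weights, so the approximate ones need not form a
  -- probability vector.
  let f : EuclideanSpace ℝ (Fin q) → EuclideanSpace ℝ (Fin q) → EuclideanSpace ℝ (Fin n) :=
    fun _ x' => fcNet lam A b 1 x'
  let g : EuclideanSpace ℝ (Fin n) → EuclideanSpace ℝ (Fin n) → EuclideanSpace ℝ (Fin k) :=
    fun z _ => G z
  let h : EuclideanSpace ℝ (Fin k ⊕ Fin r) → EuclideanSpace ℝ (Fin k ⊕ Fin r) →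
      EuclideanSpace ℝ (Fin r) :=
    fun w _ => rampMap η y (coords Sum.inl w, coords Sum.inr w i₀)
  have hf : Continuous (Function.uncurry f) := (continuous_fcNet hcont A b 1).comp continuous_snd
  have hg : Continuous (Function.uncurry g) := hG.comp continuous_fst
  have hc : Continuous fun w : EuclideanSpace ℝ (Fin k ⊕ Fin r) =>
      (coords Sum.inl w, coords Sum.inr w i₀) := by fun_prop
  have hh : Continuous (Function.uncurry h) :=
    (continuous_rampMap η y).comp (hc.comp continuous_fst)
  refine ⟨n, k, f, g, h, hf, hg, hh, fun α => ?_⟩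
  set β := toAmbient α with hβ
  set v := G (∫ x : X, fcNet lam A b 1 x.1 ∂(α : Measure X)) with hv
  have hvβ : G (∫ x, fcNet lam A b 1 x ∂β) = v := by
    rw [hβ, toAmbient, integral_map (by fun_prop)
      (continuous_fcNet hcont A b 1).measurable.aestronglyMeasurable]
  have harch : architecture f g h β =
      (unifCube r).map fun u => rampMap η y (v, u i₀) := by
    rw [architecture_eq_map hf hg hh]
    have hl : ∀ z : EuclideanSpace ℝ (Fin q) × EuclideanSpace ℝ (Fin r),
        latent f g β z = concat v z.2 := by
      intro z
      simp only [latent, f, g, integral_const, probReal_univ, one_smul, hvβ]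
    simp only [h, integral_const, probReal_univ, one_smul, hl, coords_inl_concat,
      coords_inr_concat]
    have hm : Measurable fun u : EuclideanSpace ℝ (Fin r) => rampMap η y (v, u i₀) :=
      ((continuous_rampMap η y).comp (by fun_prop)).measurable
    have := Measure.map_map (μ := β.prod (unifCube r)) hm measurable_snd
    rw [Measure.map_snd_prod, measure_univ, one_smul] at this
    exact this.symm
  have hstep : (unifCube r).map (fun u => stepMap y (p α) (u i₀)) =
      ∑ i, ENNReal.ofReal (p α i) • Measure.dirac (y i) := by
    rw [← map_stepMap y (hp0 α) (hp1 α), ← map_eval_unifCube i₀,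
      Measure.map_map (measurable_stepMap y (p α)) (by fun_prop)]
    rfl
  have hpn : ‖p α‖ ≤ 1 := by
    refine (euclidean_norm_le_sum _).trans_eq ?_
    rw [← hp1 α]
    exact Finset.sum_congr rfl fun i _ => abs_of_nonneg (hp0 α i)
  have hvn : ‖v‖ ≤ 2 := by
    have h1 := (hGd α).trans (min_le_right _ _)
    rw [dist_comm, dist_eq_norm] at h1
    have := norm_le_norm_add_norm_sub' v (p α)
    rw [← hv] at h1
    linarith
  have hms : Measurable fun u : EuclideanSpace ℝ (Fin r) => stepMap y (p α) (u i₀) :=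
    (measurable_stepMap y (p α)).comp (by fun_prop)
  have hmr : ∀ w, Measurable fun u : EuclideanSpace ℝ (Fin r) => rampMap η y (w, u i₀) := fun w =>
    ((continuous_rampMap η y).comp (by fun_prop)).measurable
  have hmr' : Measurable fun t : ℝ => rampMap η y (p α, t) :=
    ((continuous_rampMap η y).comp (by fun_prop)).measurable
  have hcost1 : ∫⁻ u, edist (stepMap y (p α) (u i₀)) (rampMap η y (p α, u i₀)) ∂unifCube r ≤
      ENNReal.ofReal (ε / 3) := by
    have h1 := lintegral_edist_stepMap_rampMap_le hη y (hp0 α)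
    rw [← map_eval_unifCube i₀, lintegral_map ((measurable_stepMap y (p α)).edist hmr')
      (by fun_prop)] at h1
    exact h1.trans (ENNReal.ofReal_le_ofReal hηε)
  have hcost2 : ∫⁻ u, edist (rampMap η y (p α, u i₀)) (rampMap η y (v, u i₀)) ∂unifCube r ≤
      ENNReal.ofReal (ε / 3) := by
    calc _ ≤ ∫⁻ _, ENNReal.ofReal (ε / 3) ∂unifCube r := by
          refine lintegral_mono_ae ?_
          filter_upwards [ae_mem_cube r] with u hu
          rw [edist_dist]
          refine ENNReal.ofReal_le_ofReal (hδε (p α, u i₀) ⟨?_, hu i₀⟩ (v, u i₀) ⟨?_, hu i₀⟩ ?_)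
          · rw [mem_closedBall_zero_iff]; linarith
          · rw [mem_closedBall_zero_iff]; exact hvn
          · rw [Prod.dist_eq, dist_self]
            exact max_le ((hGd α).trans (min_le_left _ _)) hδ.le
      _ = _ := by simp
  have hq : W1 (toAmbient (F α)) ((unifCube r).map fun u => stepMap y (p α) (u i₀)) ≤
      ENNReal.ofReal (ε / 3) := by
    rw [hstep]
    exact W1_quantize_le (F α) hY y φ hφ0 hφ1 hφε
  rw [harch]
  -- Three errors of `ε / 3`: approximate weights, ramp instead of step, and quantization.
  calc _ ≤ _ := W1_map_le_add _ _ (hmr (p α)) (hmr v)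
    _ ≤ _ := add_le_add_left (W1_map_le_add _ _ hms (hmr (p α))) _
    _ ≤ ENNReal.ofReal (ε / 3) + ENNReal.ofReal (ε / 3) + ENNReal.ofReal (ε / 3) := by gcongr
    _ = ENNReal.ofReal ε := by
      rw [← ENNReal.ofReal_add hε3.le hε3.le, ← ENNReal.ofReal_add (by positivity) hε3.le]
      congr 1
      ring

/-- The Wasserstein distance of probability measures on a point vanishes. -/
lemma W1_eq_zero_of_subsingleton {E : Type} [PseudoEMetricSpace E] [MeasurableSpace E]
    [Subsingleton E] (μ ν : Measure E) [IsProbabilityMeasure μ] [IsProbabilityMeasure ν] :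
    W1 μ ν = 0 := by
  refine nonpos_iff_eq_zero.1 ((iInf₂_le (μ.prod ν) ⟨?_, ?_⟩).trans ?_)
  · have : ∀ z : E × E, edist z.1 z.2 = 0 := fun z => by
      rw [Subsingleton.elim z.1 z.2, edist_self]
    simp [this]
  · simp
  · simp

theorem exists_continuous_architecture_approx {lam : ℝ → ℝ} (hcont : Continuous lam)
    (hbdd : ∃ M : ℝ, ∀ t, |lam t| ≤ M) (hne : ∃ s t, lam s ≠ lam t) {q r : ℕ}
    {X : Set (EuclideanSpace ℝ (Fin q))} {Y : Set (EuclideanSpace ℝ (Fin r))}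
    (hX : IsCompact X) (hY : IsCompact Y) {F : ProbabilityMeasure X → ProbabilityMeasure Y}
    (hF : Continuous F) {ε : ℝ} (hε : 0 < ε) :
    ∃ (n m : ℕ)
      (f : EuclideanSpace ℝ (Fin q) → EuclideanSpace ℝ (Fin q) → EuclideanSpace ℝ (Fin n))
      (g : EuclideanSpace ℝ (Fin n) → EuclideanSpace ℝ (Fin n) → EuclideanSpace ℝ (Fin m))
      (h : EuclideanSpace ℝ (Fin m ⊕ Fin r) → EuclideanSpace ℝ (Fin m ⊕ Fin r) →
        EuclideanSpace ℝ (Fin r)),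
      Continuous (Function.uncurry f) ∧ Continuous (Function.uncurry g) ∧
      Continuous (Function.uncurry h) ∧
      ∀ α : ProbabilityMeasure X,
        W1 (toAmbient (F α)) (architecture f g h (toAmbient α)) ≤ ENNReal.ofReal ε := by
  -- For `r = 0` there is no noise coordinate to use, but the target space is a point and any maps
  -- will do.
  rcases Nat.eq_zero_or_pos r with rfl | hr
  · have hc : ∀ {a c : ℕ}, Continuous (Function.uncurry
        fun (_ _ : EuclideanSpace ℝ (Fin a)) => (0 : EuclideanSpace ℝ (Fin c))) :=
      continuous_const
    have hc' : Continuous (Function.uncurry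
        fun (_ _ : EuclideanSpace ℝ (Fin 0 ⊕ Fin 0)) => (0 : EuclideanSpace ℝ (Fin 0))) :=
      continuous_const
    refine ⟨0, 0, fun _ _ => 0, fun _ _ => 0, fun _ _ => 0, hc, hc, hc', fun α => ?_⟩
    rw [architecture_eq_map hc hc hc']
    have := Measure.isProbabilityMeasure_map (μ := (toAmbient α).prod (unifCube 0))
      (measurable_integral_pair ((toAmbient α).prod (unifCube 0)) hc'
        (measurable_latent (n := 0) hc hc (toAmbient α))).aemeasurable
    rw [W1_eq_zero_of_subsingleton]
    exact zero_le
  · exact exists_continuous_architecture_approx_of_pos hcont hbdd hne ⟨0, hr⟩ hX hY hF hε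

theorem exists_isPairNet_architecture_approx_add {lam : ℝ → ℝ} (hcont : Continuous lam)
    (hbdd : ∃ M : ℝ, ∀ t, |lam t| ≤ M) (hne : ∃ s t, lam s ≠ lam t) {q r n m : ℕ}
    {X : Set (EuclideanSpace ℝ (Fin q))} {Y : Set (EuclideanSpace ℝ (Fin r))}
    (hX : IsCompact X) {F : ProbabilityMeasure X → ProbabilityMeasure Y}
    {f : EuclideanSpace ℝ (Fin q) → EuclideanSpace ℝ (Fin q) → EuclideanSpace ℝ (Fin n)}
    {g : EuclideanSpace ℝ (Fin n) → EuclideanSpace ℝ (Fin n) → EuclideanSpace ℝ (Fin m)}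
    {h : EuclideanSpace ℝ (Fin m ⊕ Fin r) → EuclideanSpace ℝ (Fin m ⊕ Fin r) →
      EuclideanSpace ℝ (Fin r)}
    (hf : Continuous (Function.uncurry f)) (hg : Continuous (Function.uncurry g))
    (hh : Continuous (Function.uncurry h)) {ε δ : ℝ} (hε : 0 < ε) (hδ : 0 < δ)
    (H : ∀ α : ProbabilityMeasure X,
      W1 (toAmbient (F α)) (architecture f g h (toAmbient α)) ≤ ENNReal.ofReal ε) :
    ∃ (f' : EuclideanSpace ℝ (Fin q) → EuclideanSpace ℝ (Fin q) → EuclideanSpace ℝ (Fin n))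
      (g' : EuclideanSpace ℝ (Fin n) → EuclideanSpace ℝ (Fin n) → EuclideanSpace ℝ (Fin m))
      (h' : EuclideanSpace ℝ (Fin m ⊕ Fin r) → EuclideanSpace ℝ (Fin m ⊕ Fin r) →
        EuclideanSpace ℝ (Fin r)),
      IsPairNet lam f' ∧ IsPairNet lam g' ∧ IsPairNet lam h' ∧
      ∀ α : ProbabilityMeasure X,
        W1 (toAmbient (F α)) (architecture f' g' h' (toAmbient α)) ≤ ENNReal.ofReal (ε + δ) := by
  obtain ⟨f', g', h', hf', hg', hh', H'⟩ :=
    exists_isPairNet_architecture_approx hcont hbdd hne hX hf hg hh hδ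
  refine ⟨f', g', h', hf', hg', hh', fun α => (H' α _).trans ?_⟩
  rw [ENNReal.ofReal_add hε.le hδ.le]
  exact add_le_add_left (H α) _

end StochNet

theorem mainTheorem5 (lam : ℝ → ℝ) (hcont : Continuous lam)
    (hbdd : ∃ M : ℝ, ∀ t, |lam t| ≤ M) (hnonconst : ∃ s t, lam s ≠ lam t) :
    -- real-valued maps
    (∀ (d : ℕ) (Ω : Set (EuclideanSpace ℝ (Fin d))), IsCompact Ω →
      ∀ F : ProbabilityMeasure Ω → ℝ, Continuous F → ∀ ε : ℝ, 0 < ε →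
        ∃ (N p₁ p₂ : ℕ)
          (A₁ : Matrix (Fin p₁) (Fin d) ℝ) (b₁ : Fin p₁ → ℝ) (C₁ : Matrix (Fin N) (Fin p₁) ℝ)
          (A₂ : Matrix (Fin p₂) (Fin N) ℝ) (b₂ : Fin p₂ → ℝ) (C₂ : Matrix (Fin 1) (Fin p₂) ℝ),
          ∀ α : ProbabilityMeasure Ω,
            |F α - StochNet.fcNet lam A₂ b₂ C₂
              (∫ x : Ω, StochNet.fcNet lam A₁ b₁ C₁ x.1 ∂(α : Measure Ω)) 0| < ε) ∧
    -- measure-valued maps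
    (∀ (q r : ℕ) (X : Set (EuclideanSpace ℝ (Fin q))) (Y : Set (EuclideanSpace ℝ (Fin r))),
      IsCompact X → IsCompact Y →
      ∀ F : ProbabilityMeasure X → ProbabilityMeasure Y, Continuous F → ∀ ε : ℝ, 0 < ε →
        -- approximation within `ε` by an architecture whose three maps are networks
        (∃ (n m : ℕ)
          (f : EuclideanSpace ℝ (Fin q) → EuclideanSpace ℝ (Fin q) → EuclideanSpace ℝ (Fin n))
          (g : EuclideanSpace ℝ (Fin n) → EuclideanSpace ℝ (Fin n) → EuclideanSpace ℝ (Fin m))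
          (h : EuclideanSpace ℝ (Fin m ⊕ Fin r) → EuclideanSpace ℝ (Fin m ⊕ Fin r) →
            EuclideanSpace ℝ (Fin r)),
          StochNet.IsPairNet lam f ∧ StochNet.IsPairNet lam g ∧ StochNet.IsPairNet lam h ∧
          ∀ α : ProbabilityMeasure X,
            StochNet.W1 (StochNet.toAmbient (F α))
              (StochNet.architecture f g h (StochNet.toAmbient α)) ≤ ENNReal.ofReal ε) ∧
        -- any continuous maps that approximate `F` within `ε` can be replaced by networks,
        -- at the expense of an arbitrarily small increase of `ε`
        (∀ (n m : ℕ)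
          (f : EuclideanSpace ℝ (Fin q) → EuclideanSpace ℝ (Fin q) → EuclideanSpace ℝ (Fin n))
          (g : EuclideanSpace ℝ (Fin n) → EuclideanSpace ℝ (Fin n) → EuclideanSpace ℝ (Fin m))
          (h : EuclideanSpace ℝ (Fin m ⊕ Fin r) → EuclideanSpace ℝ (Fin m ⊕ Fin r) →
            EuclideanSpace ℝ (Fin r)),
          Continuous (Function.uncurry f) → Continuous (Function.uncurry g) →
          Continuous (Function.uncurry h) →
          (∀ α : ProbabilityMeasure X,
            StochNet.W1 (StochNet.toAmbient (F α))
              (StochNet.architecture f g h (StochNet.toAmbient α)) ≤ ENNReal.ofReal ε) →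
          ∀ δ : ℝ, 0 < δ →
            ∃ (f' : EuclideanSpace ℝ (Fin q) → EuclideanSpace ℝ (Fin q) →
                EuclideanSpace ℝ (Fin n))
              (g' : EuclideanSpace ℝ (Fin n) → EuclideanSpace ℝ (Fin n) →
                EuclideanSpace ℝ (Fin m))
              (h' : EuclideanSpace ℝ (Fin m ⊕ Fin r) → EuclideanSpace ℝ (Fin m ⊕ Fin r) →
                EuclideanSpace ℝ (Fin r)),
              StochNet.IsPairNet lam f' ∧ StochNet.IsPairNet lam g' ∧
              StochNet.IsPairNet lam h' ∧
              ∀ α : ProbabilityMeasure X,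
                StochNet.W1 (StochNet.toAmbient (F α))
                  (StochNet.architecture f' g' h' (StochNet.toAmbient α))
                    ≤ ENNReal.ofReal (ε + δ))) := by
  refine ⟨fun d Ω hΩ F hF ε hε =>
    StochNet.exists_net_approx_of_real_valued hcont hbdd hnonconst d Ω hΩ F hF ε hε,
    fun q r X Y hX hY F hF ε hε => ⟨?_, fun n m f g h hf hg hh H δ hδ =>
      StochNet.exists_isPairNet_architecture_approx_add hcont hbdd hnonconst hX hf hg hh hε hδ H⟩⟩
  -- Half of `ε` goes to the approximation by continuous maps, the other half to their replacement
  -- by networks.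
  obtain ⟨n, m, f, g, h, hf, hg, hh, H⟩ := StochNet.exists_continuous_architecture_approx
    hcont hbdd hnonconst hX hY hF (half_pos hε)
  obtain ⟨f', g', h', hf', hg', hh', H'⟩ := StochNet.exists_isPairNet_architecture_approx_add
    hcont hbdd hnonconst hX hf hg hh (half_pos hε) (half_pos hε) H
  exact ⟨n, m, f', g', h', hf', hg', hh', by simpa using H'⟩
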